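/- **Setting.** Let $p\ge 2$, $0\le d\le p$, and write $\beta=(\theta,\gamma)\in\mathbb R^d\times\mathbb R^{p-d}$ for $\beta\in\mathbb R^p$. Let $b:\mathbb R\to\mathbb R$ be convex and $C^2$ with $b''$ differentiable, let $\beta^*=(\theta^*,\gamma^*)\in\mathbb R^p$, and let $z=(x,y)\in\mathbb R^p\times\mathbb R$ be a random pair such that, given $x$, $y$ has the density $c(x,y)\exp\{y\,x^\top\beta^*-b(x^\top\beta^*)\}$ with respect to a $\sigma$-finite measure on $\mathbb R$, where $c\ge 0$ is measurable. Put $\ell(\beta;z)=b(x^\top\beta)-y\,x^\top\beta$, $\mathcal L(\beta)=\mathbb E\,\ell(\beta;z)$, $J=\nabla^2\mathcal L(\beta^*)$ and $\Sigma=\mathbb E[xx^\top]$. Let $S$ be the support of $\gamma^*$, $s=|S|$, let $A\subseteq\{1,\dots,p\}$ consist of the coordinates of $\theta$ and those of $\gamma_S$ (so $|A|=d+s$), and let $\nabla_b$ and $\nabla_b^2$ denote the gradient and the Hessian restricted to the coordinates in $A$; put $J_0=J_{A,A}$. Let $z_1,\dots,z_N$ be i.i.d. copies of $z$, let $\mathcal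 I_1\subseteq\{1,\dots,N\}$ be the index set of the master site, $n_1=|\mathcal I_1|$, and let $\hat L(\beta)=\frac1N\sum_{i=1}^N\ell(\beta;z_i)$, $\hat L_1(\beta)=\frac1{n_1}\sum_{i\in\mathcal I_1}\ell(\beta;z_i)$. For $g,R>0$ let $\Lambda(g)=\{v\in\mathbb R^p:\|v\|_1\le g\|v\|_2\}$ and $\Theta(R)=\{v\in\mathbb R^p:\|v\|_2\le R\}$. **Assumptions.** With constants $\sigma_l,\sigma_u,J_l,J_u,A_0>0$ and $\sigma_x,\sigma_e,b_1,b_2,b_3$: 1. all eigenvalues of $\Sigma$ lie in $(\sigma_l,\sigma_u)$ and all eigenvalues of $J$ in $(J_l,J_u)$; 2. $\|x\|_\infty\le b_1$ almost surely, and for all $\alpha\in\mathbb R^p$, $\mathbb E\,e^{\alpha^\top x}\le e^{\sigma_x^2\|\alpha\|_2^2/2}$ and $\mathbb E\,e^{\alpha^\top\nabla\ell(\beta^*;z)}\le e^{\sigma_e^2\|\alpha\|_2^2/2}$; 3. $|b''|\le b_2$ and $|b'''|\le b_3$ on $\mathbb R$; 4. $\|J_{j,A}J_0^{-1}\|_1\le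 A_0$ for every $j\notin A$. Further let $\kappa,L,g,R_{\rm loc},R_{\rm rst}>0$. Say that the sample is *regular* if for all $\beta$ with $\|\beta-\beta^*\|_2\le R_{\rm loc}$ and all $v\in\Lambda(g)\cap\Theta(R_{\rm rst})$, $$\langle\nabla\hat L_1(\beta+v)-\nabla\hat L_1(\beta),v\rangle\ge\kappa\|v\|_2^2\quad\text{and}\quad\max\Big\{\tfrac1{n_1}\sum_{i\in\mathcal I_1}(x_i^\top v)^2,\ \tfrac1N\sum_{i=1}^N(x_i^\top v)^2\Big\}\le L\|v\|_2^2 .$$ **Proposition.** For every $c_0>0$ there is a constant $C>0$, depending only on $c_0$ and on $\sigma_l,\sigma_u,J_l,J_u,\sigma_x,\sigma_e,b_1,b_2,b_3,A_0$, such that in the setting above, whenever $t_N>0$ and $n_1\ge c_0\{(d+s)\log p+t_N\}$, there is an event of probability at least $1-e^{-t_N}$ on which all of the following hold. (a) Concentration bounds: * (i) $\|\nabla\hat L(\beta^*)\|_\infty\le C\sqrt{(\log p+t_N)/N}$; * (ii) $\|\nabla_b\hat L(\beta^*)\|_2\le C\sqrt{(d+s+t_N)/N}$; * (iii) $\max\{\|\nabla^2\hat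 L(\beta^*)-J\|_{\max},\ \|\nabla^2\hat L_1(\beta^*)-J\|_{\max}\}\le C\sqrt{(\log p+t_N)/n_1}$; * (iv) $\|\nabla_b^2\hat L_1(\beta^*)-J_0\|_2\le C\sqrt{(d+s+t_N)/n_1}$ (operator norm). (b) Restricted Lipschitz Hessian: if the sample is regular, then with $M=b_3b_1L$, for all $v\in\Lambda(g)\cap\Theta(R_{\rm rst})$, $$\|\{\nabla^2\hat L_1(\beta^*+v)-\nabla^2\hat L_1(\beta^*)\}v\|_\infty\le M\|v\|_2^2\quad\text{and}\quad\|\{\nabla^2\hat L(\beta^*+v)-\nabla^2\hat L(\beta^*)\}v\|_\infty\le M\|v\|_2^2 .$$ -/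

import Mathlib

open MeasureTheory ProbabilityTheory

noncomputable section

namespace GLM

/-- Parameter space `ℝ^p` with the Euclidean norm. -/
abbrev Vec (p : ℕ) : Type := EuclideanSpace ℝ (Fin p)

/-- One observation `z = (x, y)`: covariate vector and response. -/
abbrev Obs (p : ℕ) : Type := Vec p × ℝ

/-! ### Norms, cones, balls, supports -/

/-- The `ℓ_∞` norm of a vector. -/
def supNorm {p : ℕ} (v : Vec p) : ℝ := ‖(fun j => v j : Fin p → ℝ)‖

/-- The `ℓ_1` norm of a vector. -/
def l1Norm {p : ℕ} (v : Vec p) : ℝ := ∑ j, |v j|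

/-- The element-wise maximum norm of a matrix. -/
def maxNorm {p : ℕ} (A : Matrix (Fin p) (Fin p) ℝ) : ℝ :=
  ‖(fun i j => A i j : Fin p → Fin p → ℝ)‖

/-- The operator norm of a square matrix induced by the Euclidean norm. -/
def opNorm {ι : Type} [Fintype ι] [DecidableEq ι] (A : Matrix ι ι ℝ) : ℝ :=
  ‖Matrix.toEuclideanCLM (n := ι) (𝕜 := ℝ) A‖

/-- The `ℓ_1` cone `{v : ‖v‖₁ ≤ g ‖v‖₂}`. -/
def l1Cone (p : ℕ) (g : ℝ) : Set (Vec p) := {v | l1Norm v ≤ g * ‖v‖}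

/-- The closed Euclidean ball of radius `r` about the origin. -/
def l2Ball (p : ℕ) (r : ℝ) : Set (Vec p) := {v | ‖v‖ ≤ r}

/-- Write `β = (θ, γ)` with `θ` the first `d` coordinates.  This is the support of the nuisance
part `γ`, as a set of coordinates of `β`. -/
def nuisanceSupport {p : ℕ} (d : ℕ) (β : Vec p) : Finset (Fin p) :=
  Finset.univ.filter fun j => d ≤ j.val ∧ β j ≠ 0

/-- The coordinates of `b = (θ, γ_S)`: all of the first `d` and the support of `γ`. -/
def activeSet {p : ℕ} (d : ℕ) (β : Vec p) : Finset (Fin p) :=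
  (Finset.univ.filter fun j => j.val < d) ∪ nuisanceSupport d β

/-- The subvector `v_A`. -/
def subvec {p : ℕ} (A : Finset (Fin p)) (v : Vec p) : EuclideanSpace ℝ A :=
  WithLp.toLp 2 fun j : A => v j

/-- The principal submatrix `M_{A,A}`. -/
def principal {p : ℕ} (A : Finset (Fin p)) (M : Matrix (Fin p) (Fin p) ℝ) : Matrix A A ℝ :=
  M.submatrix (fun i : A => (i : Fin p)) (fun j : A => (j : Fin p))

/-- The Hessian matrix of `f` at `β`. -/
def hessian {p : ℕ} (f : Vec p → ℝ) (β : Vec p) : Matrix (Fin p) (Fin p) ℝ :=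
  Matrix.of fun i j =>
    iteratedFDeriv ℝ 2 f β ![EuclideanSpace.single i 1, EuclideanSpace.single j 1]

/-! ### The generalized linear model with canonical link -/

/-- The loss `ℓ(β; z) = b(xᵀβ) - y xᵀβ`. -/
def loss {p : ℕ} (b : ℝ → ℝ) (β : Vec p) (z : Obs p) : ℝ :=
  b (inner ℝ z.1 β) - z.2 * inner ℝ z.1 β

/-- The population risk `E ℓ(β; z)`, `z ∼ P`. -/
def risk {p : ℕ} (b : ℝ → ℝ) (P : Measure (Obs p)) (β : Vec p) : ℝ :=
  ∫ z, loss b β z ∂P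

/-- The Hessian `J` of the population risk at `βs`. -/
def popHessian {p : ℕ} (b : ℝ → ℝ) (P : Measure (Obs p)) (βs : Vec p) :
    Matrix (Fin p) (Fin p) ℝ :=
  hessian (risk b P) βs

/-- The empirical loss of the observations with index in `I`. -/
def empLoss {p N : ℕ} (b : ℝ → ℝ) (I : Finset (Fin N)) (z : Fin N → Obs p) (β : Vec p) : ℝ :=
  (1 / (I.card : ℝ)) * ∑ i ∈ I, loss b β (z i)

/-- The second moment matrix `Σ = E[x xᵀ]`. -/
def secondMoment {p : ℕ} (P : Measure (Obs p)) : Matrix (Fin p) (Fin p) ℝ :=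
  Matrix.of fun i j => ∫ z, z.1 i * z.1 j ∂P

/-- `P` is the law of an observation `(x, y)` of the GLM with parameter `βs`: given `x`, the
response `y` has the density `c(x, y) exp(y xᵀβs - b(xᵀβs))` with respect to some fixed
σ-finite measure `ν` on `ℝ` (Lebesgue measure, a counting measure, ...). -/
def IsGLMLaw {p : ℕ} (b : ℝ → ℝ) (βs : Vec p) (P : Measure (Obs p)) : Prop :=
  ∃ (ν : Measure ℝ) (c : Vec p → ℝ → ℝ), SigmaFinite ν ∧
    Measurable (Function.uncurry c) ∧ (∀ x y, 0 ≤ c x y) ∧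
    P = ((P.map Prod.fst).prod ν).withDensity fun z =>
      ENNReal.ofReal (c z.1 z.2 * Real.exp (z.2 * inner ℝ z.1 βs - b (inner ℝ z.1 βs)))

/-- `f(z)`, `z ∼ P`, is a `σ`-sub-Gaussian vector. -/
def IsSubGaussianVec {p : ℕ} (P : Measure (Obs p)) (f : Obs p → Vec p) (σ : ℝ) : Prop :=
  ∀ α : Vec p, Integrable (fun z => Real.exp (inner ℝ α (f z))) P ∧
    ∫ z, Real.exp (inner ℝ α (f z)) ∂P ≤ Real.exp (σ ^ 2 * ‖α‖ ^ 2 / 2)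

/-- The regularity assumptions on the population: `b` is a convex function, `P` is the law of one
observation, `βs` the true parameter, whose first `d` coordinates are the parameter of
interest.  `J` is symmetric, so its real spectrum is the set of its eigenvalues. -/
structure Regular {p : ℕ} (σl σu Jl Ju σx σe b₁ b₂ b₃ A₀ : ℝ) (d : ℕ) (b : ℝ → ℝ)
    (βs : Vec p) (P : Measure (Obs p)) : Prop where
  convex : ConvexOn ℝ Set.univ b
  contDiff : ContDiff ℝ 2 b
  differentiable : Differentiable ℝ (iteratedDeriv 2 b)
  glm : IsGLMLaw b βs P
  eig_cov : ∀ ev ∈ spectrum ℝ (secondMoment P), σl < ev ∧ ev < σu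
  eig_hess : ∀ ev ∈ spectrum ℝ (popHessian b P βs), Jl < ev ∧ ev < Ju
  subGaussian_cov : IsSubGaussianVec P Prod.fst σx
  bounded_cov : ∀ᵐ z ∂P, supNorm z.1 ≤ b₁
  subGaussian_score : IsSubGaussianVec P (fun z => gradient (fun β => loss b β z) βs) σe
  bound_two : ∀ u, |iteratedDeriv 2 b u| ≤ b₂
  bound_three : ∀ u, |iteratedDeriv 3 b u| ≤ b₃
  irrep : ∀ j ∉ activeSet d βs,
    ∑ k, |Matrix.vecMul (fun l : activeSet d βs => popHessian b P βs j l)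
      (principal (activeSet d βs) (popHessian b P βs))⁻¹ k| ≤ A₀

/-- The regularity assumption on a realized sample `z`, with master index set `I₁`: restricted
strong convexity of the master's loss, and restricted boundedness of the two empirical second
moment matrices. -/
def SampleRegular {p N : ℕ} (κ L g Rloc Rrst : ℝ) (b : ℝ → ℝ) (βs : Vec p)
    (I₁ : Finset (Fin N)) (z : Fin N → Obs p) : Prop :=
  ∀ β : Vec p, ‖β - βs‖ ≤ Rloc → ∀ v ∈ l1Cone p g ∩ l2Ball p Rrst,
    κ * ‖v‖ ^ 2 ≤
        inner ℝ (gradient (empLoss b I₁ z) (β + v) - gradient (empLoss b I₁ z) β) v ∧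
      max ((1 / (I₁.card : ℝ)) * ∑ i ∈ I₁, (inner ℝ (z i).1 v) ^ 2)
        ((1 / (N : ℝ)) * ∑ i, (inner ℝ (z i).1 v) ^ 2) ≤ L * ‖v‖ ^ 2

/-- The restricted Lipschitz property, with constant `M`, of the Hessian of `f` at `βs`. -/
def RestrictedLipschitzHessian {p : ℕ} (M g R : ℝ) (f : Vec p → ℝ) (βs : Vec p) : Prop :=
  ∀ v ∈ l1Cone p g ∩ l2Ball p R,
    supNorm (WithLp.toLp 2
      (Matrix.mulVec (hessian f (βs + v) - hessian f βs) (fun j => v j))) ≤ M * ‖v‖ ^ 2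

end GLM

end

/-! Each bound in (a) concerns an i.i.d. average of centred scalars, treated by Chernoff at
deviation `C√(T/n)` with failure probability `exp(-8T)`, followed by a union bound. For (i) and
(iii), `T = log p + t` pays for the signed coordinates or matrix entries. For (ii) and (iv), `T = d
+ s + t` pays for a `1/2`-net of the unit ball of `ℝ^A`, or for pairs of net points.

Three kinds of scalars occur. Linear forms of the score are sub-Gaussian by assumption. Hessian
entries are bounded by `b₂ b₁²`, so Hoeffding's lemma applies. Quadratic forms `b''(xᵀβ*)(xᵀu)(xᵀw)`
are products of sub-Gaussians, hence sub-exponential: the Bernstein bound `integral_exp_centred_le`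
holds only for a small Chernoff parameter. The sample size condition bounds `√((d+s+t)/n₁)`, so a
parameter proportional to it stays in range. Differentiating twice under the expectation
(`popHessian_apply`) shows that the Hessian averages have mean `J`.

Part (b) is deterministic once all covariates are bounded, which is almost sure: `b''` is
`b₃`-Lipschitz, one coordinate of `x` costs `b₁`, and what remains is the empirical second moment
along `v`. -/

namespace GLM

/-! ### Nets and norms -/

/-- The unit ball of a finite-dimensional space has a `1/2`-net of at most `5 ^ k` points. -/
theorem exists_half_net (E : Type*) [NormedAddCommGroup E] [NormedSpace ℝ E]
    [FiniteDimensional ℝ E] :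
    ∃ T : Finset E, T.card ≤ 5 ^ Module.finrank ℝ E ∧ (∀ u ∈ T, ‖u‖ ≤ 1) ∧
      ∀ v : E, ‖v‖ ≤ 1 → ∃ u ∈ T, ‖v - u‖ ≤ 1 / 2 := by
  classical
  let Sep : Finset E → Prop := fun T =>
    (∀ u ∈ T, ‖u‖ ≤ 1) ∧ ∀ u ∈ T, ∀ w ∈ T, u ≠ w → 1 / 2 ≤ ‖u - w‖
  -- Doubling turns a `1/2`-separated set in the unit ball into a `1`-separated set in the ball of
  -- radius `2`, the normalisation of the volume bound.
  have hcard : ∀ T, Sep T → T.card ≤ 5 ^ Module.finrank ℝ E := by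
    intro T hT
    have hinj : Function.Injective fun u : E => (2 : ℝ) • u :=
      smul_right_injective E two_ne_zero
    rw [← Finset.card_image_of_injective T hinj]
    apply Besicovitch.card_le_of_separated
    · intro c hc
      obtain ⟨u, hu, rfl⟩ := Finset.mem_image.1 hc
      have := hT.1 u hu
      rw [norm_smul, Real.norm_two]
      linarith
    · intro c hc c' hc' hne
      obtain ⟨u, hu, rfl⟩ := Finset.mem_image.1 hc
      obtain ⟨w, hw, rfl⟩ := Finset.mem_image.1 hc'
      have := hT.2 u hu w hw (by rintro rfl; exact hne rfl)
      rw [← smul_sub, norm_smul, Real.norm_two]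
      linarith
  -- A separated set of maximal cardinality is a net: a point far from all of it could be added.
  let S : Set ℕ := {n | ∃ T, Sep T ∧ T.card = n}
  have hne : S.Nonempty := ⟨0, ∅, ⟨by simp, by simp⟩, rfl⟩
  have hbdd : BddAbove S := ⟨5 ^ Module.finrank ℝ E, by rintro n ⟨T, hT, rfl⟩; exact hcard T hT⟩
  obtain ⟨T, hT, hTc⟩ := Nat.sSup_mem hne hbdd
  refine ⟨T, hcard T hT, hT.1, fun v hv => ?_⟩
  by_contra! hfar
  have hvT : v ∉ T := fun h => by
    have := hfar v h
    simp only [sub_self, norm_zero] at this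
    linarith
  have hsep : Sep (insert v T) := by
    refine ⟨?_, ?_⟩
    · intro u hu
      rcases Finset.mem_insert.1 hu with rfl | hu
      exacts [hv, hT.1 u hu]
    · intro u hu w hw huw
      rcases Finset.mem_insert.1 hu with hu' | hu' <;> rcases Finset.mem_insert.1 hw with hw' | hw'
      · exact absurd (hu'.trans hw'.symm) huw
      · rw [hu']; exact (hfar w hw').le
      · rw [hw', norm_sub_rev]; exact (hfar u hu').le
      · exact hT.2 u hu' w hw' huw
  have := le_csSup hbdd ⟨insert v T, hsep, rfl⟩
  rw [Finset.card_insert_of_notMem hvT, hTc] at this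
  omega

variable {E : Type*} [NormedAddCommGroup E] [InnerProductSpace ℝ E]

/-- Testing `v` against a net point near `v/‖v‖` gives `‖v‖ ≤ M + ‖v‖/2`. For `v = 0` the net still
supplies a point, whence `0 ≤ M`. -/
theorem norm_le_of_half_net {T : Finset E}
    (hnet : ∀ v : E, ‖v‖ ≤ 1 → ∃ u ∈ T, ‖v - u‖ ≤ 1 / 2) {v : E} {M : ℝ}
    (hM : ∀ u ∈ T, inner ℝ u v ≤ M) : ‖v‖ ≤ 2 * M := by
  rcases eq_or_ne v 0 with rfl | hv
  · obtain ⟨u, hu, -⟩ := hnet 0 (by simp)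
    have := hM u hu
    simp only [inner_zero_right] at this
    simpa using this
  have hv' : ‖v‖ ≠ 0 := norm_ne_zero_iff.2 hv
  obtain ⟨u, hu, hd⟩ := hnet (‖v‖⁻¹ • v) (by rw [norm_smul, norm_inv, norm_norm, inv_mul_cancel₀ hv'])
  have h1 : inner ℝ (‖v‖⁻¹ • v) v = ‖v‖ := by
    rw [real_inner_smul_left, real_inner_self_eq_norm_sq]; field_simp
  have h2 : inner ℝ (‖v‖⁻¹ • v - u) v ≤ 1 / 2 * ‖v‖ :=
    (real_inner_le_norm _ _).trans (by gcongr)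
  rw [inner_sub_left, h1] at h2
  linarith [hM u hu]

/-- The vector bound gives `‖f w‖ ≤ 2M` at net points `w`; approximating a unit vector by one gives
`‖f‖ ≤ 2M + ‖f‖/2`. -/
theorem opNorm_le_of_half_net [FiniteDimensional ℝ E] {T : Finset E}
    (hnet : ∀ v : E, ‖v‖ ≤ 1 → ∃ u ∈ T, ‖v - u‖ ≤ 1 / 2) {f : E →L[ℝ] E} {M : ℝ}
    (hM : ∀ u ∈ T, ∀ w ∈ T, inner ℝ u (f w) ≤ M) : ‖f‖ ≤ 4 * M := by
  have h0 : 0 ≤ M := by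
    obtain ⟨u, hu, -⟩ := hnet 0 (by simp)
    have := norm_le_of_half_net hnet (fun w hw => hM w hw u hu)
    linarith [norm_nonneg (f u)]
  have key : ‖f‖ ≤ 2 * M + 1 / 2 * ‖f‖ := by
    refine ContinuousLinearMap.opNorm_le_of_unit_norm (by positivity) fun v hv => ?_
    obtain ⟨w, hw, hd⟩ := hnet v hv.le
    calc ‖f v‖ = ‖f w + f (v - w)‖ := by rw [← map_add]; simp
      _ ≤ ‖f w‖ + ‖f (v - w)‖ := norm_add_le _ _
      _ ≤ 2 * M + ‖f‖ * (1 / 2) := by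
        gcongr
        · exact norm_le_of_half_net hnet (fun u hu => hM u hu w hw)
        · exact (f.le_opNorm _).trans (by gcongr)
      _ = _ := by ring
  linarith

end GLM

/-! ### Chernoff bound and exponential moments -/

namespace GLM

/-- Chernoff bound for averages of functions of an i.i.d. sample, with the deviation on the
scale `δ = √(T / n)`. -/
theorem measure_average_ge_le {α Ω ι : Type*} [MeasurableSpace α] [MeasurableSpace Ω]
    {μ : Measure Ω} {P : Measure α} {Z : ι → Ω → α} (hZ : ∀ i, Measurable (Z i))
    (hlaw : ∀ i, μ.map (Z i) = P) (hind : iIndepFun Z μ) (I : Finset ι) (hI : 0 < I.card)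
    {W : α → ℝ} (hW : Measurable W) {v l T η m C : ℝ} (hT : 0 ≤ T) (hη : 0 < η)
    (hl : l = η * √(T / I.card))
    (hint : Integrable (fun a => Real.exp (l * W a)) P)
    (hmgf : ∫ a, Real.exp (l * W a) ∂P ≤ Real.exp (v * l ^ 2))
    (hC : v * η + m / η ≤ C) :
    μ.real {ω | C * √(T / I.card) ≤ (1 / (I.card : ℝ)) * ∑ i ∈ I, W (Z i ω)}
      ≤ Real.exp (-(m * T)) := by
  have : IsProbabilityMeasure μ := hind.isProbabilityMeasure
  set n : ℝ := (I.card : ℝ) with hn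
  have hnpos : 0 < n := by rw [hn]; exact_mod_cast hI
  set δ := √(T / n) with hδ
  have hδ2 : n * δ ^ 2 = T := by
    rw [hδ, Real.sq_sqrt (by positivity)]; field_simp
  have hl0 : 0 ≤ l := by rw [hl]; positivity
  have hind' : iIndepFun (fun i ω => W (Z i ω)) μ := hind.comp (fun _ => W) fun _ => hW
  have hmeas : ∀ i, Measurable fun ω => W (Z i ω) := fun i => hW.comp (hZ i)
  have hint' : ∀ i ∈ I, Integrable (fun ω => Real.exp (l * W (Z i ω))) μ := fun i _ => by
    rw [← hlaw i] at hint
    exact hint.comp_measurable (hZ i)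
  have hset : {ω | C * δ ≤ (1 / n) * ∑ i ∈ I, W (Z i ω)} =
      {ω | n * (C * δ) ≤ (∑ i ∈ I, fun ω => W (Z i ω)) ω} := by
    ext ω
    simp only [Set.mem_ofPred_eq, Finset.sum_apply]
    rw [one_div, ← div_eq_inv_mul, le_div_iff₀' hnpos]
  rw [hset]
  have hsumint : Integrable (fun ω => Real.exp (l * (∑ i ∈ I, fun ω => W (Z i ω)) ω)) μ :=
    hind'.integrable_exp_mul_sum hmeas hint'
  refine (measure_ge_le_exp_mul_mgf _ hl0 hsumint).trans ?_
  rw [hind'.mgf_sum hmeas]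
  have hprod : ∏ i ∈ I, mgf (fun ω => W (Z i ω)) μ l ≤ ∏ _i ∈ I, Real.exp (v * l ^ 2) := by
    refine Finset.prod_le_prod (fun i _ => mgf_nonneg) fun i _ => ?_
    refine le_trans (le_of_eq ?_) hmgf
    rw [← hlaw i, integral_map (hZ i).aemeasurable]
    · rfl
    · exact ((hW.const_mul l).exp).aestronglyMeasurable
  rw [Finset.prod_const, ← Real.exp_nat_mul, ← hn] at hprod
  refine (mul_le_mul_of_nonneg_left hprod (Real.exp_nonneg _)).trans ?_
  rw [← Real.exp_add, Real.exp_le_exp, hl]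
  -- With Chernoff parameter `ηδ` and `nδ² = T`, the exponent is `T·η(vη - C)`, and `hC` says that
  -- this is at most `-mT`.
  have h1 : -(η * δ) * (n * (C * δ)) + n * (v * (η * δ) ^ 2) = (n * δ ^ 2) * (η * (v * η - C)) := by
    ring
  rw [h1, hδ2]
  have h2 : η * (v * η - C) ≤ -m := by
    have h3 : m / η ≤ C - v * η := by linarith
    rw [div_le_iff₀ hη] at h3
    linarith
  nlinarith

/-- A random variable with a sub-Gaussian moment generating function has an integrable
exponential square, with constants that depend on the variance proxy only. -/
theorem exists_exp_sq_bound (σ : ℝ) : ∃ a K : ℝ, 0 < a ∧ 1 ≤ K ∧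
    ∀ {α : Type*} [MeasurableSpace α] (P : Measure α) [IsProbabilityMeasure P] (X : α → ℝ),
      Measurable X →
      (∀ r : ℝ, Integrable (fun z => Real.exp (r * X z)) P ∧
        ∫ z, Real.exp (r * X z) ∂P ≤ Real.exp (σ ^ 2 * r ^ 2 / 2)) →
      Integrable (fun z => Real.exp (a * X z ^ 2)) P ∧ ∫ z, Real.exp (a * X z ^ 2) ∂P ≤ K := by
  -- Fernique's theorem for the standard Gaussian; `s` below is scaled so that `σ²s²/2 ≤ c`.
  obtain ⟨c, hc, hfer⟩ := IsGaussian.exists_integrable_exp_sq (gaussianReal 0 1)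
  set K₀ := ∫ x, Real.exp (c * ‖x‖ ^ 2) ∂(gaussianReal 0 1) with hK₀
  set s : ℝ := √(2 * c / (σ ^ 2 + 1)) with hs
  have hspos : 0 < s := by rw [hs]; positivity
  have hs2 : σ ^ 2 * s ^ 2 / 2 ≤ c := by
    rw [hs, Real.sq_sqrt (by positivity)]
    have : σ ^ 2 * (2 * c / (σ ^ 2 + 1)) / 2 = c * (σ ^ 2 / (σ ^ 2 + 1)) := by ring
    rw [this]
    have h1 : σ ^ 2 / (σ ^ 2 + 1) ≤ 1 := by rw [div_le_one (by positivity)]; linarith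
    nlinarith
  refine ⟨s ^ 2 / 2, max 1 K₀, by positivity, le_max_left _ _, ?_⟩
  intro α _ P _ X hX hmgf
  -- The square is linearised by an auxiliary Gaussian `g`: `exp(s²x²/2) = E exp(sxg)`. After
  -- Tonelli the assumed bound at `r = sg` leaves at most `E exp(cg²)`.
  have hmix : ∀ x : ℝ, ENNReal.ofReal (Real.exp (s ^ 2 / 2 * x ^ 2)) =
      ∫⁻ g, ENNReal.ofReal (Real.exp (s * x * g)) ∂(gaussianReal 0 1) := by
    intro x
    rw [← ofReal_integral_eq_lintegral_ofReal (integrable_exp_mul_gaussianReal _)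
      (ae_of_all _ fun _ => (Real.exp_pos _).le)]
    have := congrFun (mgf_fun_id_gaussianReal (μ := 0) (v := 1)) (s * x)
    simp only [mgf] at this
    rw [this]
    congr 2
    push_cast
    ring
  have hlint : ∫⁻ z, ENNReal.ofReal (Real.exp (s ^ 2 / 2 * X z ^ 2)) ∂P ≤ ENNReal.ofReal K₀ := by
    simp_rw [hmix]
    rw [lintegral_lintegral_swap (by fun_prop)]
    rw [hK₀, ofReal_integral_eq_lintegral_ofReal hfer (ae_of_all _ fun _ => (Real.exp_pos _).le)]
    refine lintegral_mono fun g => ?_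
    obtain ⟨hi, hb⟩ := hmgf (s * g)
    have heq : (fun z => ENNReal.ofReal (Real.exp (s * X z * g))) =
        fun z => ENNReal.ofReal (Real.exp (s * g * X z)) := by
      ext z; congr 2; ring
    rw [heq, ← ofReal_integral_eq_lintegral_ofReal hi (ae_of_all _ fun _ => (Real.exp_pos _).le)]
    refine ENNReal.ofReal_le_ofReal (hb.trans (Real.exp_le_exp.2 ?_))
    rw [Real.norm_eq_abs, sq_abs]
    nlinarith [sq_nonneg g]
  have hm : Measurable fun z => Real.exp (s ^ 2 / 2 * X z ^ 2) := by fun_prop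
  have hint : Integrable (fun z => Real.exp (s ^ 2 / 2 * X z ^ 2)) P := by
    refine ⟨hm.aestronglyMeasurable, ?_⟩
    rw [hasFiniteIntegral_iff_ofReal (ae_of_all _ fun _ => (Real.exp_pos _).le)]
    exact hlint.trans_lt ENNReal.ofReal_lt_top
  refine ⟨hint, le_trans ?_ (le_max_right _ _)⟩
  rw [← ofReal_integral_eq_lintegral_ofReal hint (ae_of_all _ fun _ => (Real.exp_pos _).le)] at hlint
  exact (ENNReal.ofReal_le_ofReal_iff (integral_nonneg fun _ => (Real.exp_pos _).le)).1 hlint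

/-- Second-order Taylor remainder, taken from the complex exponential. The linear term is kept so
that it cancels on centring. -/
theorem exp_le_one_add_add_sq_mul_exp_abs (x : ℝ) :
    Real.exp x ≤ 1 + x + x ^ 2 * Real.exp |x| := by
  have h := Complex.norm_exp_sub_sum_le_norm_mul_exp (x : ℂ) 2
  have h1 : Complex.exp x - ∑ m ∈ Finset.range 2, (x : ℂ) ^ m / (m.factorial : ℂ) =
      ((Real.exp x - (1 + x) : ℝ) : ℂ) := by
    simp [Finset.sum_range_succ]
  rw [h1, Complex.norm_real, Complex.norm_real, Real.norm_eq_abs, Real.norm_eq_abs, sq_abs] at h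
  linarith [(abs_le.1 h).2]

/-- Bernstein-type bound on the moment generating function of a centred variable with an
exponential moment. -/
theorem integral_exp_centred_le {α : Type*} [MeasurableSpace α] (P : Measure α)
    [IsProbabilityMeasure P] {W : α → ℝ} (hW : Measurable W) {a K : ℝ} (ha : 0 < a)
    (hint : Integrable (fun z => Real.exp (a * |W z|)) P)
    (hK : ∫ z, Real.exp (a * |W z|) ∂P ≤ K) {l : ℝ} (hl : |l| ≤ a / 2) :
    Integrable (fun z => Real.exp (l * (W z - ∫ z, W z ∂P))) P ∧
      ∫ z, Real.exp (l * (W z - ∫ z, W z ∂P)) ∂P ≤ Real.exp (8 * K / a ^ 2 * l ^ 2) := by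
  have hWint : Integrable W P := by
    refine Integrable.mono' (hint.const_mul (1 / a)) hW.aestronglyMeasurable (ae_of_all _ fun z => ?_)
    rw [Real.norm_eq_abs, one_div, ← div_eq_inv_mul, le_div_iff₀' ha]
    linarith [Real.add_one_le_exp (a * |W z|)]
  have hexpint : Integrable (fun z => Real.exp (l * W z)) P := by
    refine Integrable.mono' hint (hW.const_mul l).exp.aestronglyMeasurable (ae_of_all _ fun z => ?_)
    rw [Real.norm_eq_abs, abs_of_pos (Real.exp_pos _), Real.exp_le_exp]
    calc l * W z ≤ |l| * |W z| := by rw [← abs_mul]; exact le_abs_self _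
      _ ≤ a * |W z| := by gcongr; linarith
  -- Half of the exponential moment `exp(a|W|)` dominates `exp|lW|`; the other half absorbs `W²`, at
  -- the price `8/a²`.
  have hpt : ∀ z, Real.exp (l * W z) ≤
      1 + l * W z + 8 / a ^ 2 * l ^ 2 * Real.exp (a * |W z|) := by
    intro z
    refine (exp_le_one_add_add_sq_mul_exp_abs _).trans ?_
    have h1 : Real.exp |l * W z| ≤ Real.exp (a / 2 * |W z|) := by
      rw [Real.exp_le_exp, abs_mul]; gcongr
    have h2 : W z ^ 2 ≤ 8 / a ^ 2 * Real.exp (a / 2 * |W z|) := by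
      have := Real.quadratic_le_exp_of_nonneg (x := a / 2 * |W z|) (by positivity)
      have h3 : (a / 2 * |W z|) ^ 2 = a ^ 2 / 4 * W z ^ 2 := by rw [mul_pow, sq_abs]; ring
      have h4 : a ^ 2 / 8 * W z ^ 2 ≤ Real.exp (a / 2 * |W z|) := by
        have : 0 ≤ a / 2 * |W z| := by positivity
        nlinarith
      rw [div_mul_eq_mul_div, le_div_iff₀ (by positivity)]
      linarith
    have h5 : Real.exp (a * |W z|) = Real.exp (a / 2 * |W z|) * Real.exp (a / 2 * |W z|) := by
      rw [← Real.exp_add]; congr 1; ring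
    rw [h5]
    have : (l * W z) ^ 2 * Real.exp |l * W z| ≤
        (l ^ 2 * (8 / a ^ 2 * Real.exp (a / 2 * |W z|))) * Real.exp (a / 2 * |W z|) := by
      rw [mul_pow]; gcongr
    linarith
  -- The variable is not yet centred: `1 + r ≤ exp r` puts the mean into the exponent, where the
  -- factor `exp(-l E W)` removes it.
  have hmean : ∫ z, Real.exp (l * W z) ∂P ≤
      Real.exp (l * ∫ z, W z ∂P + 8 * K / a ^ 2 * l ^ 2) := by
    have hi1 : Integrable (fun z => 1 + l * W z) P := (integrable_const 1).add (hWint.const_mul l)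
    have hi2 : Integrable (fun z => 8 / a ^ 2 * l ^ 2 * Real.exp (a * |W z|)) P :=
      hint.const_mul _
    calc ∫ z, Real.exp (l * W z) ∂P
        ≤ ∫ z, (1 + l * W z + 8 / a ^ 2 * l ^ 2 * Real.exp (a * |W z|)) ∂P :=
          integral_mono hexpint (hi1.add hi2) hpt
      _ = 1 + l * ∫ z, W z ∂P + 8 / a ^ 2 * l ^ 2 * ∫ z, Real.exp (a * |W z|) ∂P := by
          rw [integral_add hi1 hi2, integral_add (integrable_const 1) (hWint.const_mul l),
            integral_const_mul, integral_const_mul]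
          simp
      _ ≤ 1 + l * ∫ z, W z ∂P + 8 / a ^ 2 * l ^ 2 * K := by gcongr
      _ = (l * ∫ z, W z ∂P + 8 * K / a ^ 2 * l ^ 2) + 1 := by ring
      _ ≤ _ := Real.add_one_le_exp _
  have hsplit : ∀ z, Real.exp (l * (W z - ∫ z, W z ∂P)) =
      Real.exp (-(l * ∫ z, W z ∂P)) * Real.exp (l * W z) := by
    intro z; rw [← Real.exp_add]; congr 1; ring
  simp_rw [hsplit]
  refine ⟨hexpint.const_mul _, ?_⟩
  rw [integral_const_mul]
  refine (mul_le_mul_of_nonneg_left hmean (Real.exp_nonneg _)).trans (le_of_eq ?_)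
  rw [← Real.exp_add]; congr 1; ring

/-- Hoeffding's lemma for a variable bounded in absolute value. -/
theorem integral_exp_centred_le_of_bounded {α : Type*} [MeasurableSpace α] (P : Measure α)
    [IsProbabilityMeasure P] {W : α → ℝ} (hW : Measurable W) {B : ℝ}
    (hB : ∀ᵐ z ∂P, |W z| ≤ B) (l : ℝ) :
    Integrable (fun z => Real.exp (l * (W z - ∫ z, W z ∂P))) P ∧
      ∫ z, Real.exp (l * (W z - ∫ z, W z ∂P)) ∂P ≤ Real.exp (B ^ 2 / 2 * l ^ 2) := by
  have h := hasSubgaussianMGF_of_mem_Icc (a := -B) (b := B) hW.aemeasurable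
    (hB.mono fun z hz => abs_le.1 hz)
  refine ⟨h.integrable_exp_mul l, (h.mgf_le l).trans (le_of_eq ?_)⟩
  congr 1
  push_cast
  rw [Real.norm_eq_abs, div_pow, sq_abs]
  ring

end GLM

/-! ### Derivatives of the loss, the empirical loss and the risk -/

namespace GLM

set_option maxSynthPendingDepth 3

variable {b : ℝ → ℝ}

theorem hasDerivAt_of_contDiff_two (hb : ContDiff ℝ 2 b) (u : ℝ) :
    HasDerivAt b (deriv b u) u :=
  (hb.differentiable (by norm_num) u).hasDerivAt

theorem hasDerivAt_deriv_of_contDiff_two (hb : ContDiff ℝ 2 b) (u : ℝ) :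
    HasDerivAt (deriv b) (iteratedDeriv 2 b u) u := by
  have h : Differentiable ℝ (deriv b) :=
    ((contDiff_succ_iff_deriv (n := 1)).1 (by simpa [one_add_one_eq_two] using hb)).2.2.differentiable
      (by norm_num)
  rw [iteratedDeriv_succ, iteratedDeriv_one]
  exact (h u).hasDerivAt

theorem continuous_deriv_of_contDiff_two (hb : ContDiff ℝ 2 b) : Continuous (deriv b) :=
  continuous_iff_continuousAt.2 fun u => (hasDerivAt_deriv_of_contDiff_two hb u).continuousAt

theorem continuous_iteratedDeriv_two (hb : ContDiff ℝ 2 b) : Continuous (iteratedDeriv 2 b) :=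
  hb.continuous_iteratedDeriv 2 le_rfl

/-- A bounded `b''` gives `b'` linear growth, which supplies the dominating functions for the score.
-/
theorem abs_deriv_le (hb : ContDiff ℝ 2 b) {b₂ : ℝ} (h₂ : ∀ u, |iteratedDeriv 2 b u| ≤ b₂)
    (u : ℝ) : |deriv b u| ≤ |deriv b 0| + b₂ * |u| := by
  have h := Convex.norm_image_sub_le_of_norm_hasDerivWithin_le (f := deriv b)
    (s := Set.univ) (x := 0) (y := u)
    (fun x _ => (hasDerivAt_deriv_of_contDiff_two hb x).hasDerivWithinAt)
    (fun x _ => h₂ x) convex_univ trivial trivial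
  simp only [Real.norm_eq_abs, sub_zero] at h
  linarith [abs_sub_abs_le_abs_sub (deriv b u) (deriv b 0)]

section InnerProductSpace

variable {E : Type*} [NormedAddCommGroup E] [InnerProductSpace ℝ E]

theorem iteratedFDeriv_two_of_hasFDerivAt {f : E → ℝ} {f' : E → E →L[ℝ] ℝ}
    {f'' : E →L[ℝ] E →L[ℝ] ℝ} {β : E} (h : ∀ w, HasFDerivAt f (f' w) w)
    (h' : HasFDerivAt f' f'' β) (u v : E) :
    iteratedFDeriv ℝ 2 f β ![u, v] = f'' u v := by
  have hf : fderiv ℝ f = f' := funext fun w => (h w).fderiv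
  simp [iteratedFDeriv_two_apply, hf, h'.fderiv]

/-- The canonical-link loss on an inner product space. -/
def innerLoss (b : ℝ → ℝ) (β : E) (z : E × ℝ) : ℝ :=
  b (inner ℝ z.1 β) - z.2 * inner ℝ z.1 β

/-- The derivative of the loss in the parameter. -/
noncomputable def lossDeriv (b : ℝ → ℝ) (β : E) (z : E × ℝ) : E →L[ℝ] ℝ :=
  (deriv b (inner ℝ z.1 β) - z.2) • innerSL ℝ z.1

/-- The second derivative of the loss in the parameter. -/
noncomputable def lossDeriv₂ (b : ℝ → ℝ) (β : E) (z : E × ℝ) : E →L[ℝ] E →L[ℝ] ℝ :=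
  iteratedDeriv 2 b (inner ℝ z.1 β) • (innerSL ℝ z.1).smulRight (innerSL ℝ z.1)

theorem hasFDerivAt_inner_right (x β : E) :
    HasFDerivAt (fun w : E => inner ℝ x w) (innerSL ℝ x) β :=
  (innerSL ℝ x).hasFDerivAt

theorem hasFDerivAt_innerLoss (hb : ContDiff ℝ 2 b) (z : E × ℝ) (β : E) :
    HasFDerivAt (fun w => innerLoss b w z) (lossDeriv b β z) β := by
  have h1 := (hasDerivAt_of_contDiff_two hb (inner ℝ z.1 β)).comp_hasFDerivAt β
    (hasFDerivAt_inner_right z.1 β)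
  have h2 := (hasFDerivAt_inner_right z.1 β).const_mul z.2
  rw [lossDeriv, sub_smul]
  exact h1.sub h2

theorem hasFDerivAt_lossDeriv (hb : ContDiff ℝ 2 b) (z : E × ℝ) (β : E) :
    HasFDerivAt (fun w => lossDeriv b w z) (lossDeriv₂ b β z) β := by
  have h1 := ((hasDerivAt_deriv_of_contDiff_two hb (inner ℝ z.1 β)).comp_hasFDerivAt β
    (hasFDerivAt_inner_right z.1 β)).sub_const z.2
  have h2 := h1.smul_const (innerSL ℝ z.1 : E →L[ℝ] ℝ)
  refine h2.congr_fderiv ?_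
  ext u v
  simp [lossDeriv₂, mul_assoc]

theorem lossDeriv₂_apply (β : E) (z : E × ℝ) (u v : E) :
    lossDeriv₂ b β z u v =
      iteratedDeriv 2 b (inner ℝ z.1 β) * (inner ℝ z.1 u * inner ℝ z.1 v) := by
  simp [lossDeriv₂]

theorem continuous_innerLoss (hb : ContDiff ℝ 2 b) (β : E) : Continuous (innerLoss b β) := by
  have := hb.continuous
  unfold innerLoss
  fun_prop

theorem continuous_lossDeriv (hb : ContDiff ℝ 2 b) (β : E) : Continuous (lossDeriv b β) := by
  have := continuous_deriv_of_contDiff_two hb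
  unfold lossDeriv
  fun_prop

theorem continuous_lossDeriv₂ (hb : ContDiff ℝ 2 b) (β : E) : Continuous (lossDeriv₂ b β) := by
  have := continuous_iteratedDeriv_two hb
  -- Written through the continuous bilinear map `smulRightL`, the rank-one form is visibly
  -- continuous in `x`.
  have h : lossDeriv₂ b β = fun z : E × ℝ => iteratedDeriv 2 b (inner ℝ z.1 β) •
      ContinuousLinearMap.smulRightL ℝ E (E →L[ℝ] ℝ) (innerSL ℝ z.1) (innerSL ℝ z.1) := by
    ext z u v; simp [lossDeriv₂]
  rw [h]
  fun_prop

theorem norm_lossDeriv₂_le {b₂ : ℝ} (h₂ : ∀ u, |iteratedDeriv 2 b u| ≤ b₂) (β : E)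
    (z : E × ℝ) : ‖lossDeriv₂ b β z‖ ≤ b₂ * ‖z.1‖ ^ 2 := by
  unfold lossDeriv₂
  rw [norm_smul, ContinuousLinearMap.norm_smulRight_apply, innerSL_apply_norm, ← sq]
  gcongr
  exact h₂ _

/-- Differentiation under the expectation, twice, of the risk of the canonical-link loss with
bounded covariates. -/
theorem iteratedFDeriv_two_integral_innerLoss [FiniteDimensional ℝ E] [MeasurableSpace E]
    [BorelSpace E] {P : Measure (E × ℝ)} [IsFiniteMeasure P] (hb : ContDiff ℝ 2 b) {b₂ R : ℝ}
    (h₂ : ∀ u, |iteratedDeriv 2 b u| ≤ b₂) (hxn : ∀ᵐ z ∂P, ‖z.1‖ ≤ R) (hR : 0 ≤ R)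
    (hyx : Integrable (fun z => |z.2| * ‖z.1‖) P) (βs u v : E) :
    iteratedFDeriv ℝ 2 (fun β => ∫ z, innerLoss b β z ∂P) βs ![u, v] =
      ∫ z, iteratedDeriv 2 b (inner ℝ z.1 βs) * (inner ℝ z.1 u * inner ℝ z.1 v) ∂P := by
  have : ProperSpace E := FiniteDimensional.proper_real E
  have hb2 : 0 ≤ b₂ := (abs_nonneg _).trans (h₂ 0)
  have hc := hb.continuous
  have hxint : Integrable (fun z : E × ℝ => ‖z.1‖) P :=
    Integrable.of_bound (C := R) (by fun_prop) (hxn.mono fun z hz => by simpa using hz)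
  have hx2int : Integrable (fun z : E × ℝ => ‖z.1‖ ^ 2) P :=
    Integrable.of_bound (C := R ^ 2) (by fun_prop) (hxn.mono fun z hz => by
      rw [norm_pow, norm_norm]; gcongr)
  have hlossint : ∀ β : E, Integrable (innerLoss b β) P := by
    intro β
    -- Bounded covariates confine `xᵀβ` to a compact interval, on which `b` is bounded.
    obtain ⟨M, hM⟩ := (isCompact_Icc (a := -(R * ‖β‖)) (b := R * ‖β‖)).exists_bound_of_continuousOn
      hc.continuousOn
    have h1 : Integrable (fun z : E × ℝ => b (inner ℝ z.1 β)) P := by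
      refine Integrable.of_bound (C := M) (by fun_prop) (hxn.mono fun z hz => hM _ ?_)
      refine abs_le.1 ((abs_real_inner_le_norm _ _).trans ?_)
      gcongr
    have h2 : Integrable (fun z : E × ℝ => z.2 * inner ℝ z.1 β) P := by
      refine Integrable.mono' (hyx.mul_const ‖β‖) (by fun_prop) (ae_of_all _ fun z => ?_)
      rw [norm_mul, Real.norm_eq_abs, mul_assoc]
      gcongr
      exact abs_real_inner_le_norm _ _
    exact h1.sub h2
  -- Domination uniform over the unit ball about `β₀`; the response enters only through the
  -- integrable `|y|‖x‖`.
  have hbound : ∀ (β₀ : E) (z : E × ℝ), ‖z.1‖ ≤ R → ∀ β ∈ Metric.ball β₀ 1,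
      ‖lossDeriv b β z‖ ≤
        (|deriv b 0| + b₂ * (R * (‖β₀‖ + 1))) * ‖z.1‖ + |z.2| * ‖z.1‖ := by
    intro β₀ z hz β hβ
    have hβ' : ‖β‖ ≤ ‖β₀‖ + 1 := by
      have : ‖β - β₀‖ < 1 := by simpa [dist_eq_norm] using hβ
      linarith [norm_le_norm_add_norm_sub' β β₀]
    unfold lossDeriv
    rw [norm_smul, innerSL_apply_norm, ← add_mul, Real.norm_eq_abs]
    gcongr
    refine (abs_sub _ _).trans ?_
    gcongr
    refine (abs_deriv_le hb h₂ _).trans ?_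
    gcongr
    refine (abs_real_inner_le_norm _ _).trans ?_
    gcongr
  have hbint : ∀ β₀ : E, Integrable (fun z : E × ℝ =>
      (|deriv b 0| + b₂ * (R * (‖β₀‖ + 1))) * ‖z.1‖ + |z.2| * ‖z.1‖) P :=
    fun β₀ => (hxint.const_mul _).add hyx
  have hderivint : ∀ β : E, Integrable (lossDeriv b β) P := fun β =>
    Integrable.mono' (hbint β) (continuous_lossDeriv hb β).aestronglyMeasurable
      (hxn.mono fun z hz => hbound β z hz β (Metric.mem_ball_self one_pos))
  have h1 : ∀ β : E, HasFDerivAt (fun β => ∫ z, innerLoss b β z ∂P)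
      (∫ z, lossDeriv b β z ∂P) β := by
    intro β
    exact hasFDerivAt_integral_of_dominated_of_fderiv_le (Metric.ball_mem_nhds β one_pos)
      (Filter.Eventually.of_forall fun w => (continuous_innerLoss hb w).aestronglyMeasurable)
      (hlossint β) (continuous_lossDeriv hb β).aestronglyMeasurable
      (hxn.mono fun z hz => hbound β z hz) (hbint β)
      (ae_of_all _ fun z w _ => hasFDerivAt_innerLoss hb z w)
  have h2 : HasFDerivAt (fun β : E => ∫ z, lossDeriv b β z ∂P)
      (∫ z, lossDeriv₂ b βs z ∂P) βs :=
    hasFDerivAt_integral_of_dominated_of_fderiv_le (Metric.ball_mem_nhds βs one_pos)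
      (Filter.Eventually.of_forall fun w => (continuous_lossDeriv hb w).aestronglyMeasurable)
      (hderivint βs) (continuous_lossDeriv₂ hb βs).aestronglyMeasurable
      (ae_of_all _ fun z w _ => norm_lossDeriv₂_le h₂ w z) (hx2int.const_mul b₂)
      (ae_of_all _ fun z w _ => hasFDerivAt_lossDeriv hb z w)
  have hint₂ : Integrable (lossDeriv₂ b βs) P :=
    Integrable.mono' (hx2int.const_mul b₂) (continuous_lossDeriv₂ hb βs).aestronglyMeasurable
      (ae_of_all _ fun z => norm_lossDeriv₂_le h₂ βs z)
  rw [iteratedFDeriv_two_of_hasFDerivAt h1 h2, ContinuousLinearMap.integral_apply hint₂,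
    ContinuousLinearMap.integral_apply (hint₂.apply_continuousLinearMap _)]
  simp [lossDeriv₂_apply]

variable {ι : Type*} (I : Finset ι) (z : ι → E × ℝ) (c : ℝ)

theorem hasFDerivAt_sum_innerLoss (hb : ContDiff ℝ 2 b) (β : E) :
    HasFDerivAt (fun w => c * ∑ i ∈ I, innerLoss b w (z i))
      (c • ∑ i ∈ I, lossDeriv b β (z i)) β :=
  (HasFDerivAt.fun_sum fun i _ => hasFDerivAt_innerLoss hb (z i) β).const_mul _

theorem gradient_sum_innerLoss [CompleteSpace E] (hb : ContDiff ℝ 2 b) (β : E) :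
    gradient (fun w => c * ∑ i ∈ I, innerLoss b w (z i)) β =
      c • ∑ i ∈ I, (deriv b (inner ℝ (z i).1 β) - (z i).2) • (z i).1 := by
  refine HasGradientAt.gradient ?_
  rw [hasGradientAt_iff_hasFDerivAt]
  refine (hasFDerivAt_sum_innerLoss I z c hb β).congr_fderiv ?_
  ext v
  simp [lossDeriv]

theorem iteratedFDeriv_two_sum_innerLoss (hb : ContDiff ℝ 2 b) (β u v : E) :
    iteratedFDeriv ℝ 2 (fun w => c * ∑ i ∈ I, innerLoss b w (z i)) β ![u, v] =
      c * ∑ i ∈ I, iteratedDeriv 2 b (inner ℝ (z i).1 β) *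
        (inner ℝ (z i).1 u * inner ℝ (z i).1 v) := by
  have h : HasFDerivAt (fun w => c • ∑ i ∈ I, lossDeriv b w (z i))
      (c • ∑ i ∈ I, lossDeriv₂ b β (z i)) β :=
    (HasFDerivAt.fun_sum fun i _ => hasFDerivAt_lossDeriv hb (z i) β).fun_const_smul _
  rw [iteratedFDeriv_two_of_hasFDerivAt (hasFDerivAt_sum_innerLoss I z c hb) h]
  simp [lossDeriv₂_apply]

end InnerProductSpace

variable {p N : ℕ}

/-- The score `∇ℓ(β; z)`. -/
theorem gradient_loss (hb : ContDiff ℝ 2 b) (z : Obs p) (β : Vec p) :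
    gradient (fun w => loss b w z) β = (deriv b (inner ℝ z.1 β) - z.2) • z.1 := by
  have h := gradient_sum_innerLoss {()} (fun _ => z) 1 hb β
  simpa [innerLoss, loss] using h

theorem gradient_empLoss (I : Finset (Fin N)) (z : Fin N → Obs p) (hb : ContDiff ℝ 2 b)
    (β : Vec p) : gradient (empLoss b I z) β =
      (1 / (I.card : ℝ)) • ∑ i ∈ I, (deriv b (inner ℝ (z i).1 β) - (z i).2) • (z i).1 :=
  gradient_sum_innerLoss I z _ hb β

theorem hessian_empLoss (I : Finset (Fin N)) (z : Fin N → Obs p) (hb : ContDiff ℝ 2 b)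
    (β : Vec p) (j k : Fin p) : hessian (empLoss b I z) β j k =
      (1 / (I.card : ℝ)) * ∑ i ∈ I,
        iteratedDeriv 2 b (inner ℝ (z i).1 β) * ((z i).1 j * (z i).1 k) := by
  have h := iteratedFDeriv_two_sum_innerLoss I z (1 / (I.card : ℝ)) hb β
    (EuclideanSpace.single j 1) (EuclideanSpace.single k 1)
  simp only [EuclideanSpace.inner_single_right, one_mul, conj_trivial] at h
  exact h

theorem abs_apply_le_supNorm (v : Vec p) (j : Fin p) : |v j| ≤ supNorm v :=
  norm_le_pi_norm (fun j => v j : Fin p → ℝ) j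

theorem supNorm_le {v : Vec p} {M : ℝ} (hM : 0 ≤ M) (h : ∀ j, |v j| ≤ M) : supNorm v ≤ M :=
  (pi_norm_le_iff_of_nonneg hM).2 h

theorem norm_le_sum_abs (v : Vec p) : ‖v‖ ≤ ∑ j, |v j| := by
  have h : v = ∑ j, v j • EuclideanSpace.single j (1 : ℝ) := by
    ext k
    simp [Finset.sum_apply, Pi.single_apply]
  calc ‖v‖ = ‖∑ j, v j • EuclideanSpace.single j (1 : ℝ)‖ := by rw [← h]
    _ ≤ ∑ j, ‖v j • EuclideanSpace.single j (1 : ℝ)‖ := norm_sum_le _ _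
    _ = ∑ j, |v j| := by simp [norm_smul]

/-- The crude factor `p` serves integrability and differentiation under the expectation; it enters
no concentration constant. -/
theorem norm_le_card_mul_supNorm (v : Vec p) : ‖v‖ ≤ p * supNorm v := by
  refine (norm_le_sum_abs v).trans ?_
  refine (Finset.sum_le_card_nsmul _ _ _ fun j _ => abs_apply_le_supNorm v j).trans ?_
  simp

/-- A sub-Gaussian vector is integrable. -/
theorem IsSubGaussianVec.integrable_apply {P : Measure (Obs p)} {f : Obs p → Vec p} {σ : ℝ}
    (hf : IsSubGaussianVec P f σ) (j : Fin p) : Integrable (fun w => f w j) P := by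
  have h : HasSubgaussianMGF (fun w => f w j) (⟨σ ^ 2, sq_nonneg σ⟩ : NNReal) P := by
    have hsub : ∀ r : ℝ, (fun w => Real.exp (r * f w j)) =
        fun w => Real.exp (inner ℝ (EuclideanSpace.single j r : Vec p) (f w)) := by
      intro r; ext w; simp [EuclideanSpace.inner_single_left]
    refine ⟨fun r => ?_, fun r => ?_⟩
    · rw [hsub]; exact (hf _).1
    · unfold mgf
      rw [hsub]
      refine ((hf _).2).trans (le_of_eq ?_)
      simp only [PiLp.norm_single, Real.norm_eq_abs, sq_abs]
      rfl
  exact h.integrable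

variable {P : Measure (Obs p)} [IsProbabilityMeasure P] {βs : Vec p} {σe b₁ b₂ : ℝ}

/-- No moment of `y` is assumed directly. It is recovered from `y x_j = b'(xᵀβ*) x_j - (∇ℓ)_j`,
whose terms are bounded and sub-Gaussian respectively. -/
theorem integrable_abs_response_mul_norm (hb : ContDiff ℝ 2 b)
    (h₂ : ∀ u, |iteratedDeriv 2 b u| ≤ b₂) (hx : ∀ᵐ z ∂P, supNorm z.1 ≤ b₁)
    (hs : IsSubGaussianVec P (fun z => gradient (fun β => loss b β z) βs) σe) :
    Integrable (fun z => |z.2| * ‖z.1‖) P := by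
  have hb2 : 0 ≤ b₂ := (abs_nonneg _).trans (h₂ 0)
  have hc' := continuous_deriv_of_contDiff_two hb
  have hj : ∀ j, Integrable (fun z : Obs p => z.2 * z.1 j) P := by
    intro j
    have h1 := hs.integrable_apply j
    have h3 : Integrable (fun z : Obs p => deriv b (inner ℝ z.1 βs) * z.1 j) P := by
      refine Integrable.of_bound (C := (|deriv b 0| + b₂ * (p * b₁ * ‖βs‖)) * b₁)
        (by fun_prop) (hx.mono fun z hz => ?_)
      have hz1 : |z.1 j| ≤ b₁ := (abs_apply_le_supNorm _ _).trans hz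
      have hb1 : 0 ≤ b₁ := (abs_nonneg _).trans hz1
      rw [norm_mul, Real.norm_eq_abs, Real.norm_eq_abs]
      gcongr
      refine (abs_deriv_le hb h₂ _).trans ?_
      gcongr
      refine (abs_real_inner_le_norm _ _).trans ?_
      gcongr
      exact (norm_le_card_mul_supNorm _).trans (by gcongr)
    refine (h3.sub h1).congr (ae_of_all _ fun z => ?_)
    simp only [Pi.sub_apply, gradient_loss hb, PiLp.smul_apply, smul_eq_mul]
    ring
  refine Integrable.mono' (integrable_finsetSum Finset.univ fun j _ => (hj j).abs)
    (by fun_prop) (ae_of_all _ fun z => ?_)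
  rw [norm_mul, norm_norm, Real.norm_eq_abs, abs_abs]
  simp only [abs_mul, ← Finset.mul_sum]
  gcongr
  exact norm_le_sum_abs _

/-- Identifies `J` as the mean of the summands of the empirical Hessian at `β*`. -/
theorem popHessian_apply (hb : ContDiff ℝ 2 b)
    (h₂ : ∀ u, |iteratedDeriv 2 b u| ≤ b₂) (hx : ∀ᵐ z ∂P, supNorm z.1 ≤ b₁)
    (hs : IsSubGaussianVec P (fun z => gradient (fun β => loss b β z) βs) σe) (j k : Fin p) :
    popHessian b P βs j k =
      ∫ z, iteratedDeriv 2 b (inner ℝ z.1 βs) * (z.1 j * z.1 k) ∂P := by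
  have hyx := integrable_abs_response_mul_norm hb h₂ hx hs
  have hxn : ∀ᵐ z ∂P, ‖z.1‖ ≤ p * |b₁| := hx.mono fun z hz =>
    (norm_le_card_mul_supNorm _).trans (by gcongr; exact hz.trans (le_abs_self _))
  have h := iteratedFDeriv_two_integral_innerLoss hb h₂ hxn (by positivity) hyx βs
    (EuclideanSpace.single j 1) (EuclideanSpace.single k 1)
  simp only [EuclideanSpace.inner_single_right, one_mul, conj_trivial] at h
  exact h

end GLM

/-! ### Restricted Lipschitz Hessian, union bounds and concentration -/

namespace GLM

variable {p N : ℕ} {b : ℝ → ℝ}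

theorem abs_iteratedDeriv_two_sub_le (hb : Differentiable ℝ (iteratedDeriv 2 b)) {b₃ : ℝ}
    (h₃ : ∀ u, |iteratedDeriv 3 b u| ≤ b₃) (x y : ℝ) :
    |iteratedDeriv 2 b y - iteratedDeriv 2 b x| ≤ b₃ * |y - x| := by
  refine Convex.norm_image_sub_le_of_norm_deriv_le (s := Set.univ) (fun u _ => hb u)
    (fun u _ => ?_) convex_univ trivial trivial
  rw [← iteratedDeriv_succ]
  exact h₃ u

/-- The restricted Lipschitz property of the empirical Hessian under restricted boundedness of the
empirical second moments. -/
theorem restrictedLipschitzHessian_empLoss {b₁ b₃ L g R : ℝ} (hc : ContDiff ℝ 2 b)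
    (hb : Differentiable ℝ (iteratedDeriv 2 b)) (h₃ : ∀ u, |iteratedDeriv 3 b u| ≤ b₃)
    {I : Finset (Fin N)} (hI : I.Nonempty) {z : Fin N → Obs p} {βs : Vec p}
    (hx : ∀ i, supNorm (z i).1 ≤ b₁) (hL : 0 ≤ L)
    (hreg : ∀ v ∈ l1Cone p g ∩ l2Ball p R,
      (1 / (I.card : ℝ)) * ∑ i ∈ I, (inner ℝ (z i).1 v) ^ 2 ≤ L * ‖v‖ ^ 2) :
    RestrictedLipschitzHessian (b₃ * b₁ * L) g R (empLoss b I z) βs := by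
  intro v hv
  have hb3 : 0 ≤ b₃ := (abs_nonneg _).trans (h₃ 0)
  obtain ⟨i₀, -⟩ := hI
  have hb1 : 0 ≤ b₁ := le_trans (norm_nonneg _) (hx i₀)
  refine supNorm_le (by positivity) fun j => ?_
  have hentry : Matrix.mulVec (hessian (empLoss b I z) (βs + v) - hessian (empLoss b I z) βs)
      (fun k => v k) j = (1 / (I.card : ℝ)) * ∑ i ∈ I,
        (iteratedDeriv 2 b (inner ℝ (z i).1 (βs + v)) - iteratedDeriv 2 b (inner ℝ (z i).1 βs)) *
          ((z i).1 j * inner ℝ (z i).1 v) := by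
    simp only [Matrix.mulVec, dotProduct, Matrix.sub_apply, hessian_empLoss I z hc, ← mul_sub,
      ← Finset.sum_sub_distrib, mul_assoc, Finset.sum_mul, ← Finset.mul_sum, ← sub_mul]
    rw [Finset.sum_comm]
    congr 1
    refine Finset.sum_congr rfl fun i _ => ?_
    rw [← Finset.mul_sum, ← Finset.mul_sum, PiLp.inner_apply (z i).1 v]
    simp only [RCLike.inner_apply, conj_trivial, mul_comm (v _)]
  rw [PiLp.toLp_apply, hentry, abs_mul, abs_of_nonneg (by positivity : (0 : ℝ) ≤ 1 / (I.card : ℝ))]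
  -- One factor `|xᵀv|` comes from the increment of `b''`, the other from applying the Hessian to
  -- `v`.
  calc (1 / (I.card : ℝ)) * |∑ i ∈ I,
        (iteratedDeriv 2 b (inner ℝ (z i).1 (βs + v)) - iteratedDeriv 2 b (inner ℝ (z i).1 βs)) *
          ((z i).1 j * inner ℝ (z i).1 v)|
      ≤ (1 / (I.card : ℝ)) * ∑ i ∈ I, b₃ * b₁ * (inner ℝ (z i).1 v) ^ 2 := by
        gcongr
        refine (Finset.abs_sum_le_sum_abs _ _).trans (Finset.sum_le_sum fun i _ => ?_)
        have h1 := abs_iteratedDeriv_two_sub_le hb h₃ (inner ℝ (z i).1 βs)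
          (inner ℝ (z i).1 (βs + v))
        rw [inner_add_right, add_sub_cancel_left] at h1
        rw [inner_add_right, abs_mul, abs_mul]
        calc _ ≤ (b₃ * |inner ℝ (z i).1 v|) * (b₁ * |inner ℝ (z i).1 v|) := by
              gcongr
              exact (abs_apply_le_supNorm _ _).trans (hx i)
          _ = b₃ * b₁ * |inner ℝ (z i).1 v| ^ 2 := by ring
          _ = _ := by rw [sq_abs]
    _ = b₃ * b₁ * ((1 / (I.card : ℝ)) * ∑ i ∈ I, (inner ℝ (z i).1 v) ^ 2) := by
        rw [← Finset.mul_sum]; ring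
    _ ≤ b₃ * b₁ * (L * ‖v‖ ^ 2) := by
        exact mul_le_mul_of_nonneg_left (hreg v hv) (by positivity)
    _ = _ := by ring

/-- Union bound over a finite family of upper deviations. -/
theorem measureReal_not_forall_le {Ω ι : Type*} [MeasurableSpace Ω] {μ : Measure Ω}
    [IsFiniteMeasure μ] (s : Finset ι) (f : ι → Ω → ℝ) {r q : ℝ}
    (h : ∀ i ∈ s, μ.real {ω | r ≤ f i ω} ≤ q) :
    μ.real {ω | ¬ ∀ i ∈ s, f i ω ≤ r} ≤ s.card * q := by
  have hsub : {ω | ¬ ∀ i ∈ s, f i ω ≤ r} ⊆ ⋃ i ∈ s, {ω | r ≤ f i ω} := by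
    intro ω hω
    simp only [Set.mem_ofPred_eq, not_forall, not_le] at hω
    obtain ⟨i, hi, hlt⟩ := hω
    exact Set.mem_biUnion hi hlt.le
  calc μ.real {ω | ¬ ∀ i ∈ s, f i ω ≤ r} ≤ μ.real (⋃ i ∈ s, {ω | r ≤ f i ω}) :=
        measureReal_mono hsub (measure_ne_top _ _)
    _ ≤ ∑ i ∈ s, μ.real {ω | r ≤ f i ω} := measureReal_biUnion_finset_le _ _
    _ ≤ s.card * q := by
        rw [← nsmul_eq_mul]; exact Finset.sum_le_card_nsmul _ _ _ h

/-- `2p²` counts signed matrix entries. Since `p ≥ 2`, `2p² · p⁻⁸ ≤ 1/16`, small enough for all bad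
events to fit into `e^{-t}`. -/
theorem two_mul_sq_mul_exp_le {p : ℕ} (hp : 2 ≤ p) {t : ℝ} (ht : 0 < t) :
    2 * (p : ℝ) ^ 2 * Real.exp (-(8 * (Real.log p + t))) ≤ Real.exp (-t) / 16 := by
  have hp' : (2 : ℝ) ≤ p := by exact_mod_cast hp
  have hp0 : (0 : ℝ) < p := by linarith
  have h1 : Real.exp (-(8 * (Real.log p + t))) = ((p : ℝ) ^ 8)⁻¹ * Real.exp (-(8 * t)) := by
    have h2 : -(8 * (Real.log p + t)) = -((8 : ℕ) * Real.log p) + -(8 * t) := by push_cast; ring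
    rw [h2, Real.exp_add, Real.exp_neg, Real.exp_nat_mul, Real.exp_log hp0]
  have h3 : Real.exp (-(8 * t)) ≤ Real.exp (-t) := Real.exp_le_exp.2 (by linarith)
  have h4 : 2 * (p : ℝ) ^ 2 * ((p : ℝ) ^ 8)⁻¹ ≤ 1 / 16 := by
    rw [← div_eq_mul_inv, div_le_div_iff₀ (by positivity) (by norm_num)]
    have : (2 : ℝ) ^ 6 ≤ (p : ℝ) ^ 6 := by gcongr
    have h5 : (p : ℝ) ^ 8 = (p : ℝ) ^ 2 * (p : ℝ) ^ 6 := by ring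
    rw [h5]
    nlinarith [sq_nonneg (p : ℝ)]
  rw [h1, ← mul_assoc]
  calc _ ≤ 1 / 16 * Real.exp (-t) := by gcongr
    _ = _ := by ring

/-- `25^k = (5^k)²` counts pairs of net points. As `25e⁻⁸ ≤ 1/16`, one factor, available because `D
≥ 1`, yields the `1/16`. -/
theorem pow_mul_exp_le {k D : ℕ} (hk : k ≤ D) (hD : 1 ≤ D) {t : ℝ} (ht : 0 < t) :
    (25 : ℝ) ^ k * Real.exp (-(8 * (D + t))) ≤ Real.exp (-t) / 16 := by
  have h1 : Real.exp (-(8 * (D + t))) = Real.exp (-8) ^ D * Real.exp (-(8 * t)) := by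
    rw [← Real.exp_nat_mul, ← Real.exp_add]; congr 1; ring
  have h3 : Real.exp (-(8 * t)) ≤ Real.exp (-t) := Real.exp_le_exp.2 (by linarith)
  have h4 : 25 * Real.exp (-8) ≤ 1 / 16 := by
    have h5 : (2.7 : ℝ) ≤ Real.exp 1 := by linarith [Real.exp_one_gt_d9]
    have h6 : Real.exp 8 = Real.exp 1 ^ 8 := by rw [← Real.exp_nat_mul]; norm_num
    have h7 : (400 : ℝ) ≤ Real.exp 8 := by
      rw [h6]
      calc (400 : ℝ) ≤ 2.7 ^ 8 := by norm_num
        _ ≤ _ := by gcongr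
    rw [Real.exp_neg, ← div_eq_mul_inv, div_le_div_iff₀ (Real.exp_pos _) (by norm_num)]
    linarith
  calc (25 : ℝ) ^ k * Real.exp (-(8 * (D + t)))
      ≤ 25 ^ D * (Real.exp (-8) ^ D * Real.exp (-t)) := by
        rw [h1]; gcongr; norm_num
    _ = (25 * Real.exp (-8)) ^ D * Real.exp (-t) := by rw [mul_pow]; ring
    _ ≤ 1 / 16 * Real.exp (-t) := by
        gcongr
        exact (pow_le_of_le_one (by positivity) (h4.trans (by norm_num)) (by omega)).trans h4
    _ = _ := by ring

/-! ### Extension of a subvector by zero -/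

/-- Extension of a subvector by zero. -/
noncomputable def extendVec (A : Finset (Fin p)) (u : EuclideanSpace ℝ A) : Vec p :=
  ∑ j : A, EuclideanSpace.single (j : Fin p) (u j)

/-- Extension is adjoint to restriction, so directions in `ℝ^A` become directions in `ℝ^p`, where
the assumptions live. -/
theorem inner_extendVec (A : Finset (Fin p)) (u : EuclideanSpace ℝ A) (x : Vec p) :
    inner ℝ (extendVec A u) x = inner ℝ u (subvec A x) := by
  simp [extendVec, subvec, sum_inner, PiLp.inner_apply, mul_comm]

theorem norm_subvec_le (A : Finset (Fin p)) (x : Vec p) : ‖subvec A x‖ ≤ ‖x‖ := by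
  rw [EuclideanSpace.norm_eq, EuclideanSpace.norm_eq]
  refine Real.sqrt_le_sqrt ?_
  simp only [subvec]
  rw [Finset.sum_coe_sort A fun j => ‖x j‖ ^ 2]
  exact Finset.sum_le_univ_sum_of_nonneg fun _ => by positivity

theorem norm_extendVec_le (A : Finset (Fin p)) (u : EuclideanSpace ℝ A) :
    ‖extendVec A u‖ ≤ ‖u‖ := by
  rcases eq_or_ne (extendVec A u) 0 with h | h
  · rw [h, norm_zero]; exact norm_nonneg _
  have h1 : ‖extendVec A u‖ * ‖extendVec A u‖ ≤ ‖u‖ * ‖extendVec A u‖ := by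
    rw [← real_inner_self_eq_norm_mul_norm, inner_extendVec]
    refine (real_inner_le_norm _ _).trans ?_
    gcongr
    exact norm_subvec_le _ _
  exact le_of_mul_le_mul_right h1 (norm_pos_iff.2 h)

/-! ### Concentration -/

section Concentration

variable {Ω : Type*} [MeasurableSpace Ω] {μ : Measure Ω} {P : Measure (Obs p)}
  {Z : Fin N → Ω → Obs p} {βs : Vec p} {σx σe b₁ b₂ t C : ℝ}

/-- The moment bound on the score has no linear term, so no centring is needed. Chernoff is used
with `v = σe²/2`, `η = 1`, `m = 8`. -/
theorem measure_score_average_ge_le (hZ : ∀ i, Measurable (Z i))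
    (hlaw : ∀ i, μ.map (Z i) = P) (hind : iIndepFun Z μ) {I : Finset (Fin N)} (hI : 0 < I.card)
    (hb : ContDiff ℝ 2 b)
    (hs : IsSubGaussianVec P (fun z => gradient (fun β => loss b β z) βs) σe)
    {α : Vec p} (hα : ‖α‖ ≤ 1) {T : ℝ} (hT : 0 ≤ T) (hC : σe ^ 2 / 2 + 8 ≤ C) :
    μ.real {ω | C * √(T / I.card) ≤
      inner ℝ α (gradient (empLoss b I fun i => Z i ω) βs)} ≤ Real.exp (-(8 * T)) := by
  have hc' := continuous_deriv_of_contDiff_two hb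
  set W : Obs p → ℝ := fun z => inner ℝ α ((deriv b (inner ℝ z.1 βs) - z.2) • z.1) with hWdef
  have hW : Measurable W := by
    have : Continuous W := by fun_prop
    exact this.measurable
  have hset : ∀ ω, inner ℝ α (gradient (empLoss b I fun i => Z i ω) βs) =
      (1 / (I.card : ℝ)) * ∑ i ∈ I, W (Z i ω) := by
    intro ω
    rw [gradient_empLoss I _ hb, real_inner_smul_right, inner_sum]
  simp_rw [hset]
  set l := 1 * √(T / I.card) with hl
  have hexp : (fun z => Real.exp (l * W z)) =
      fun z => Real.exp (inner ℝ (l • α) (gradient (fun β => loss b β z) βs)) := by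
    ext z
    rw [gradient_loss hb, real_inner_smul_left]
  obtain ⟨h1, h2⟩ := hs (l • α)
  refine measure_average_ge_le hZ hlaw hind I hI hW (v := σe ^ 2 / 2) hT one_pos hl
    (by rw [hexp]; exact h1) (by
      rw [hexp]
      refine h2.trans (Real.exp_le_exp.2 ?_)
      rw [norm_smul, mul_pow, Real.norm_eq_abs, sq_abs]
      have : ‖α‖ ^ 2 ≤ 1 := pow_le_one₀ (norm_nonneg _) hα
      have h3 : σe ^ 2 * (l ^ 2 * ‖α‖ ^ 2) ≤ σe ^ 2 * (l ^ 2 * 1) := by gcongr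
      linarith) (by linarith)

theorem measure_supNorm_gradient_empLoss (hp : 2 ≤ p) (ht : 0 < t) (hZ : ∀ i, Measurable (Z i))
    (hlaw : ∀ i, μ.map (Z i) = P) (hind : iIndepFun Z μ) {I : Finset (Fin N)} (hI : 0 < I.card)
    (hb : ContDiff ℝ 2 b)
    (hs : IsSubGaussianVec P (fun z => gradient (fun β => loss b β z) βs) σe)
    (hC : σe ^ 2 / 2 + 8 ≤ C) :
    μ.real {ω | ¬ supNorm (gradient (empLoss b I fun i => Z i ω) βs) ≤
      C * √((Real.log p + t) / I.card)} ≤ Real.exp (-t) / 16 := by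
  have : IsProbabilityMeasure μ := hind.isProbabilityMeasure
  have hlog : 0 ≤ Real.log p := Real.log_natCast_nonneg p
  have hC0 : 0 ≤ C := le_trans (by positivity) hC
  -- The sup norm is the largest inner product with the `2p` vectors `±e_j`.
  let sgn : Bool → ℝ := fun e => if e then 1 else -1
  have key := measureReal_not_forall_le (μ := μ) (Finset.univ : Finset (Fin p × Bool))
    (fun q ω => inner ℝ (EuclideanSpace.single q.1 (sgn q.2) : Vec p)
      (gradient (empLoss b I fun i => Z i ω) βs))
    (r := C * √((Real.log p + t) / I.card)) fun q _ =>
      measure_score_average_ge_le hZ hlaw hind hI hb hs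
        (by rw [PiLp.norm_single]; cases q.2 <;> simp [sgn])
        (by positivity) hC
  refine (measureReal_mono ?_).trans (key.trans ?_)
  · intro ω hω hall
    refine hω (supNorm_le (by positivity) fun j => abs_le'.2 ⟨?_, ?_⟩)
    · simpa only [sgn, EuclideanSpace.inner_single_left, if_true, conj_trivial, one_mul]
        using hall (j, true) (Finset.mem_univ _)
    · simpa only [sgn, EuclideanSpace.inner_single_left, Bool.false_eq_true, if_false,
        conj_trivial, neg_one_mul] using hall (j, false) (Finset.mem_univ _)
  · refine le_trans ?_ (two_mul_sq_mul_exp_le hp ht)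
    gcongr
    have hp' : (1 : ℝ) ≤ p := by exact_mod_cast (by omega : 1 ≤ p)
    simp only [Finset.card_univ, Fintype.card_prod, Fintype.card_fin, Fintype.card_bool]
    push_cast
    nlinarith

theorem measure_norm_subvec_gradient_empLoss (ht : 0 < t) (hZ : ∀ i, Measurable (Z i))
    (hlaw : ∀ i, μ.map (Z i) = P) (hind : iIndepFun Z μ) {I : Finset (Fin N)} (hI : 0 < I.card)
    (hb : ContDiff ℝ 2 b)
    (hs : IsSubGaussianVec P (fun z => gradient (fun β => loss b β z) βs) σe)
    {A : Finset (Fin p)} {D : ℕ} (hA : A.card ≤ D) (hD : 1 ≤ D)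
    (hC : 2 * (σe ^ 2 / 2 + 8) ≤ C) :
    μ.real {ω | ¬ ‖subvec A (gradient (empLoss b I fun i => Z i ω) βs)‖ ≤
      C * √((D + t) / I.card)} ≤ Real.exp (-t) / 16 := by
  have : IsProbabilityMeasure μ := hind.isProbabilityMeasure
  obtain ⟨T, hTcard, hT1, hnet⟩ := exists_half_net (EuclideanSpace ℝ A)
  rw [finrank_euclideanSpace, Fintype.card_coe] at hTcard
  have key := measureReal_not_forall_le (μ := μ) T
    (fun u ω => inner ℝ (extendVec A u) (gradient (empLoss b I fun i => Z i ω) βs))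
    (r := C / 2 * √((D + t) / I.card)) fun u hu =>
      measure_score_average_ge_le hZ hlaw hind hI hb hs
        ((norm_extendVec_le A u).trans (hT1 u hu)) (by positivity) (by linarith)
  refine (measureReal_mono ?_).trans (key.trans ?_)
  · intro ω hω hall
    refine hω ((norm_le_of_half_net hnet
      (M := C / 2 * √((D + t) / I.card)) fun u hu => ?_).trans (le_of_eq (by ring)))
    rw [← inner_extendVec]
    exact hall u hu
  · refine le_trans ?_ (pow_mul_exp_le hA hD ht)
    gcongr
    calc (T.card : ℝ) ≤ 5 ^ A.card := by exact_mod_cast hTcard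
      -- A single net would need `5^|A|`; the looser count lets vectors and matrices share one tail
      -- estimate.
      _ ≤ 25 ^ A.card := by gcongr; norm_num

/-- The weighted quadratic form `b''(xᵀβ) (xᵀu) (xᵀw)`. -/
noncomputable def hessForm (b : ℝ → ℝ) (β u w : Vec p) (z : Obs p) : ℝ :=
  iteratedDeriv 2 b (inner ℝ z.1 β) * (inner ℝ z.1 u * inner ℝ z.1 w)

theorem measurable_hessForm (hb : ContDiff ℝ 2 b) (β u w : Vec p) :
    Measurable (hessForm b β u w) := by
  have := continuous_iteratedDeriv_two hb
  have h : Continuous (hessForm b β u w) := by unfold hessForm; fun_prop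
  exact h.measurable

theorem hessForm_single (β : Vec p) (j k : Fin p) (z : Obs p) :
    hessForm b β (EuclideanSpace.single j 1) (EuclideanSpace.single k 1) z =
      iteratedDeriv 2 b (inner ℝ z.1 β) * (z.1 j * z.1 k) := by
  simp [hessForm, EuclideanSpace.inner_single_right]

theorem abs_hessForm_single_le (h₂ : ∀ u, |iteratedDeriv 2 b u| ≤ b₂)
    (hx : ∀ᵐ z ∂P, supNorm z.1 ≤ b₁) (j k : Fin p) :
    ∀ᵐ z ∂P, |hessForm b βs (EuclideanSpace.single j 1) (EuclideanSpace.single k 1) z| ≤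
      b₂ * b₁ ^ 2 := by
  have hb2 : 0 ≤ b₂ := (abs_nonneg _).trans (h₂ 0)
  refine hx.mono fun z hz => ?_
  have hj := (abs_apply_le_supNorm z.1 j).trans hz
  have hk := (abs_apply_le_supNorm z.1 k).trans hz
  have hb1 : 0 ≤ b₁ := (abs_nonneg _).trans hj
  rw [hessForm_single, abs_mul, abs_mul, sq]
  gcongr
  exact h₂ _

theorem measure_maxNorm_hessian_empLoss [IsProbabilityMeasure P] (hp : 2 ≤ p) (ht : 0 < t) (hZ : ∀ i, Measurable (Z i))
    (hlaw : ∀ i, μ.map (Z i) = P) (hind : iIndepFun Z μ) {I : Finset (Fin N)} (hI : 0 < I.card)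
    (hb : ContDiff ℝ 2 b) (h₂ : ∀ u, |iteratedDeriv 2 b u| ≤ b₂)
    (hx : ∀ᵐ z ∂P, supNorm z.1 ≤ b₁)
    (hs : IsSubGaussianVec P (fun z => gradient (fun β => loss b β z) βs) σe)
    (hC : (b₂ * b₁ ^ 2) ^ 2 / 2 + 8 ≤ C) :
    μ.real {ω | ¬ maxNorm (hessian (empLoss b I fun i => Z i ω) βs - popHessian b P βs) ≤
      C * √((Real.log p + t) / I.card)} ≤ Real.exp (-t) / 16 := by
  have : IsProbabilityMeasure μ := hind.isProbabilityMeasure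
  have hlog : 0 ≤ Real.log p := Real.log_natCast_nonneg p
  have hC0 : 0 ≤ C := le_trans (by positivity) hC
  have hn : (I.card : ℝ) ≠ 0 := by exact_mod_cast hI.ne'
  let sgn : Bool → ℝ := fun e => if e then 1 else -1
  let F : Fin p × Fin p → Obs p → ℝ := fun q =>
    hessForm b βs (EuclideanSpace.single q.1 1) (EuclideanSpace.single q.2 1)
  have hFm : ∀ q, Measurable (F q) := fun q => measurable_hessForm hb _ _ _
  have key := measureReal_not_forall_le (μ := μ) (Finset.univ : Finset ((Fin p × Fin p) × Bool))
    (fun q ω => (1 / (I.card : ℝ)) * ∑ i ∈ I, sgn q.2 * (F q.1 (Z i ω) - ∫ z, F q.1 z ∂P))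
    (r := C * √((Real.log p + t) / I.card)) (q := Real.exp (-(8 * (Real.log p + t)))) fun q _ => by
      set l := 1 * √((Real.log p + t) / I.card) with hl
      obtain ⟨h1, h3⟩ := integral_exp_centred_le_of_bounded P (hFm q.1)
        (abs_hessForm_single_le h₂ hx q.1.1 q.1.2) (l * sgn q.2)
      -- The sign squares away, so Hoeffding's bound is the same for both tails.
      have hsq : (l * sgn q.2) ^ 2 = l ^ 2 := by cases q.2 <;> simp [sgn]
      simp only [mul_assoc, hsq] at h1 h3
      exact measure_average_ge_le hZ hlaw hind I hI
        (W := fun z => sgn q.2 * (F q.1 z - ∫ z, F q.1 z ∂P))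
        (((hFm q.1).sub_const _).const_mul _) (by positivity) one_pos hl h1 h3 (by linarith)
  refine (measureReal_mono ?_).trans (key.trans ?_)
  · intro ω hω hall
    have hentry : ∀ j k, (hessian (empLoss b I fun i => Z i ω) βs - popHessian b P βs) j k =
        (1 / (I.card : ℝ)) * ∑ i ∈ I, (F (j, k) (Z i ω) - ∫ z, F (j, k) z ∂P) := by
      intro j k
      rw [Matrix.sub_apply, hessian_empLoss I _ hb, popHessian_apply hb h₂ hx hs]
      simp only [F, hessForm_single]
      rw [Finset.sum_sub_distrib, mul_sub, Finset.sum_const, nsmul_eq_mul, ← mul_assoc,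
        one_div_mul_cancel hn, one_mul]
    have hr : 0 ≤ C * √((Real.log p + t) / I.card) := by positivity
    refine hω ((pi_norm_le_iff_of_nonneg hr).2 fun j => (pi_norm_le_iff_of_nonneg hr).2 fun k => ?_)
    rw [Real.norm_eq_abs, hentry]
    refine abs_le'.2 ⟨?_, ?_⟩
    · simpa [sgn] using hall ((j, k), true) (Finset.mem_univ _)
    · have := hall ((j, k), false) (Finset.mem_univ _)
      simp only [sgn, Bool.false_eq_true, if_false, ← Finset.mul_sum] at this
      linarith
  · refine le_trans (le_of_eq ?_) (two_mul_sq_mul_exp_le hp ht)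
    congr 1
    simp only [Finset.card_univ, Fintype.card_prod, Fintype.card_fin, Fintype.card_bool]
    push_cast
    ring

/-- `|xy| ≤ (x² + y²)/2` and `e^{(r+s)/2} ≤ (e^r + e^s)/2` reduce the product to the two exponential
squares, so the same `K` works. Dividing by `b₂ + 1` avoids `b₂ = 0`. -/
theorem integral_exp_abs_hessForm_le (hb : ContDiff ℝ 2 b)
    (h₂ : ∀ u, |iteratedDeriv 2 b u| ≤ b₂) {a K : ℝ} (ha : 0 < a)
    (hexp : ∀ α : Vec p, ‖α‖ ≤ 1 → Integrable (fun z => Real.exp (a * (inner ℝ z.1 α) ^ 2)) P ∧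
      ∫ z, Real.exp (a * (inner ℝ z.1 α) ^ 2) ∂P ≤ K)
    {u w : Vec p} (hu : ‖u‖ ≤ 1) (hw : ‖w‖ ≤ 1) :
    Integrable (fun z => Real.exp (a / (b₂ + 1) * |hessForm b βs u w z|)) P ∧
      ∫ z, Real.exp (a / (b₂ + 1) * |hessForm b βs u w z|) ∂P ≤ K := by
  have hb2 : 0 ≤ b₂ := (abs_nonneg _).trans (h₂ 0)
  obtain ⟨hu1, hu2⟩ := hexp u hu
  obtain ⟨hw1, hw2⟩ := hexp w hw
  have hpt : ∀ z : Obs p, Real.exp (a / (b₂ + 1) * |hessForm b βs u w z|) ≤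
      1 / 2 * (Real.exp (a * (inner ℝ z.1 u) ^ 2) + Real.exp (a * (inner ℝ z.1 w) ^ 2)) := by
    intro z
    set x : ℝ := inner ℝ z.1 u
    set y : ℝ := inner ℝ z.1 w
    have h1 : |hessForm b βs u w z| ≤ (b₂ + 1) * (1 / 2 * (x ^ 2 + y ^ 2)) := by
      unfold hessForm
      rw [abs_mul]
      gcongr
      · exact (h₂ _).trans (by linarith)
      · rw [abs_mul, ← sq_abs x, ← sq_abs y]
        linarith [two_mul_le_add_sq |x| |y|]
    have h2 : a / (b₂ + 1) * |hessForm b βs u w z| ≤ a * x ^ 2 / 2 + a * y ^ 2 / 2 := by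
      calc _ ≤ a / (b₂ + 1) * ((b₂ + 1) * (1 / 2 * (x ^ 2 + y ^ 2))) := by gcongr
        _ = _ := by field_simp
    refine (Real.exp_le_exp.2 h2).trans ?_
    have h3 : ∀ r : ℝ, Real.exp (a * r ^ 2) = Real.exp (a * r ^ 2 / 2) ^ 2 := by
      intro r; rw [← Real.exp_nat_mul]; congr 1; push_cast; ring
    rw [Real.exp_add, h3 x, h3 y]
    linarith [two_mul_le_add_sq (Real.exp (a * x ^ 2 / 2)) (Real.exp (a * y ^ 2 / 2))]
  have hdom := (hu1.add hw1).const_mul (1 / 2)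
  have hint : Integrable (fun z => Real.exp (a / (b₂ + 1) * |hessForm b βs u w z|)) P := by
    refine Integrable.mono' hdom ?_ (ae_of_all _ fun z => ?_)
    · have := measurable_hessForm hb βs u w
      exact Measurable.aestronglyMeasurable (by fun_prop)
    · rw [Real.norm_eq_abs, abs_of_pos (Real.exp_pos _)]; exact hpt z
  refine ⟨hint, (integral_mono hint hdom hpt).trans ?_⟩
  have h4 : ∫ z, (1 / 2 : ℝ) * ((fun z : Obs p => Real.exp (a * (inner ℝ z.1 u) ^ 2)) +
      fun z : Obs p => Real.exp (a * (inner ℝ z.1 w) ^ 2)) z ∂P = 1 / 2 *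
        (∫ z, Real.exp (a * (inner ℝ z.1 u) ^ 2) ∂P + ∫ z, Real.exp (a * (inner ℝ z.1 w) ^ 2) ∂P) := by
    rw [integral_const_mul, integral_add' hu1 hw1]
  refine h4.trans_le ?_
  linarith

theorem hessForm_extendVec (A : Finset (Fin p)) (β : Vec p) (u w : EuclideanSpace ℝ A)
    (z : Obs p) : hessForm b β (extendVec A u) (extendVec A w) z =
      ∑ j : A, ∑ k : A, u j * w k *
        hessForm b β (EuclideanSpace.single (j : Fin p) 1) (EuclideanSpace.single (k : Fin p) 1) z := by
  simp only [hessForm_single]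
  rw [hessForm, real_inner_comm (extendVec A u) z.1, real_inner_comm (extendVec A w) z.1, inner_extendVec, inner_extendVec,
    PiLp.inner_apply u, PiLp.inner_apply w, Finset.sum_mul_sum, Finset.mul_sum]
  refine Finset.sum_congr rfl fun j _ => ?_
  rw [Finset.mul_sum]
  refine Finset.sum_congr rfl fun k _ => ?_
  simp [subvec]
  ring

theorem inner_toEuclideanCLM {ι : Type} [Fintype ι] [DecidableEq ι] (M : Matrix ι ι ℝ)
    (u w : EuclideanSpace ℝ ι) :
    inner ℝ u (Matrix.toEuclideanCLM (n := ι) (𝕜 := ℝ) M w) = ∑ j, ∑ k, u j * w k * M j k := by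
  rw [PiLp.inner_apply]
  refine Finset.sum_congr rfl fun j _ => ?_
  rw [Matrix.ofLp_toEuclideanCLM]
  simp only [Matrix.mulVec, dotProduct, RCLike.inner_apply, conj_trivial, Finset.sum_mul]
  exact Finset.sum_congr rfl fun k _ => by ring

/-- The forms are only sub-exponential: `hηD` keeps the Chernoff parameter in the Bernstein range.
The `4` in `hC` is the loss of the net argument. -/
theorem measure_opNorm_hessian_empLoss [IsProbabilityMeasure P] (ht : 0 < t) (hZ : ∀ i, Measurable (Z i))
    (hlaw : ∀ i, μ.map (Z i) = P) (hind : iIndepFun Z μ) {I : Finset (Fin N)} (hI : 0 < I.card)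
    (hb : ContDiff ℝ 2 b) (h₂ : ∀ u, |iteratedDeriv 2 b u| ≤ b₂)
    (hx : ∀ᵐ z ∂P, supNorm z.1 ≤ b₁)
    (hs : IsSubGaussianVec P (fun z => gradient (fun β => loss b β z) βs) σe)
    {a K η : ℝ} (ha : 0 < a) (hη : 0 < η)
    (hexp : ∀ α : Vec p, ‖α‖ ≤ 1 → Integrable (fun z => Real.exp (a * (inner ℝ z.1 α) ^ 2)) P ∧
      ∫ z, Real.exp (a * (inner ℝ z.1 α) ^ 2) ∂P ≤ K)
    {A : Finset (Fin p)} {D : ℕ} (hA : A.card ≤ D) (hD : 1 ≤ D)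
    (hηD : η * √((D + t) / I.card) ≤ a / (b₂ + 1) / 2)
    (hC : 4 * (8 * K / (a / (b₂ + 1)) ^ 2 * η + 8 / η) ≤ C) :
    μ.real {ω | ¬ opNorm (principal A (hessian (empLoss b I fun i => Z i ω) βs) -
      principal A (popHessian b P βs)) ≤ C * √((D + t) / I.card)} ≤ Real.exp (-t) / 16 := by
  have : IsProbabilityMeasure μ := hind.isProbabilityMeasure
  have hb2 : 0 ≤ b₂ := (abs_nonneg _).trans (h₂ 0)
  have hn : (I.card : ℝ) ≠ 0 := by exact_mod_cast hI.ne'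
  obtain ⟨T, hTcard, hT1, hnet⟩ := exists_half_net (EuclideanSpace ℝ A)
  rw [finrank_euclideanSpace, Fintype.card_coe] at hTcard
  let F : EuclideanSpace ℝ A × EuclideanSpace ℝ A → Obs p → ℝ := fun q =>
    hessForm b βs (extendVec A q.1) (extendVec A q.2)
  have hFm : ∀ q, Measurable (F q) := fun q => measurable_hessForm hb _ _ _
  have key := measureReal_not_forall_le (μ := μ) (T ×ˢ T)
    (fun q ω => (1 / (I.card : ℝ)) * ∑ i ∈ I, (F q (Z i ω) - ∫ z, F q z ∂P))
    (r := C / 4 * √((D + t) / I.card)) (q := Real.exp (-(8 * (D + t)))) fun q hq => by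
      obtain ⟨hq1, hq2⟩ := Finset.mem_product.1 hq
      set l := η * √((D + t) / I.card) with hl
      obtain ⟨hi, hK⟩ := integral_exp_abs_hessForm_le (βs := βs) hb h₂ ha hexp
        ((norm_extendVec_le A q.1).trans (hT1 _ hq1)) ((norm_extendVec_le A q.2).trans (hT1 _ hq2))
      obtain ⟨h1, h3⟩ := integral_exp_centred_le P (hFm q) (by positivity) hi hK (l := l)
        (by rwa [abs_of_nonneg (by positivity)])
      exact measure_average_ge_le hZ hlaw hind I hI (W := fun z => F q z - ∫ z, F q z ∂P)
        ((hFm q).sub_const _) (by positivity) hη hl h1 h3 (by linarith)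
  refine (measureReal_mono ?_).trans (key.trans ?_)
  · intro ω hω hall
    refine hω ((opNorm_le_of_half_net hnet
      (M := C / 4 * √((D + t) / I.card)) fun u hu w hw => ?_).trans (le_of_eq (by ring)))
    refine le_trans (le_of_eq ?_) (hall (u, w) (Finset.mk_mem_product hu hw))
    have hint : ∀ j k : A, Integrable (fun z => u j * w k * hessForm b βs
        (EuclideanSpace.single (j : Fin p) 1) (EuclideanSpace.single (k : Fin p) 1) z) P :=
      fun j k => (Integrable.of_bound (measurable_hessForm hb _ _ _).aestronglyMeasurable _
        (abs_hessForm_single_le h₂ hx j k)).const_mul _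
    have hmean : ∫ z, F (u, w) z ∂P =
        ∑ j : A, ∑ k : A, u j * w k * popHessian b P βs j k := by
      simp only [F, hessForm_extendVec]
      rw [integral_finsetSum _ fun j _ => integrable_finsetSum _ fun k _ => hint j k]
      refine Finset.sum_congr rfl fun j _ => ?_
      rw [integral_finsetSum _ fun k _ => hint j k]
      refine Finset.sum_congr rfl fun k _ => ?_
      rw [integral_const_mul, popHessian_apply hb h₂ hx hs]
      simp only [hessForm_single]
    have hemp : (1 / (I.card : ℝ)) * ∑ i ∈ I, F (u, w) (Z i ω) =
        ∑ j : A, ∑ k : A, u j * w k * hessian (empLoss b I fun i => Z i ω) βs j k := by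
      simp only [F, hessForm_extendVec, hessian_empLoss I _ hb, hessForm_single]
      rw [Finset.sum_comm, Finset.mul_sum]
      refine Finset.sum_congr rfl fun j _ => ?_
      rw [Finset.sum_comm, Finset.mul_sum]
      refine Finset.sum_congr rfl fun k _ => ?_
      rw [← Finset.mul_sum]
      ring
    rw [Finset.sum_sub_distrib, mul_sub, Finset.sum_const, nsmul_eq_mul, ← mul_assoc,
      one_div_mul_cancel hn, one_mul, hemp, hmean, inner_toEuclideanCLM, ← Finset.sum_sub_distrib]
    refine Finset.sum_congr rfl fun j _ => ?_
    rw [← Finset.sum_sub_distrib]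
    refine Finset.sum_congr rfl fun k _ => ?_
    simp only [principal, Matrix.sub_apply, Matrix.submatrix_apply]
    ring
  · refine le_trans ?_ (pow_mul_exp_le hA hD ht)
    gcongr
    have h5 : (T.card : ℝ) ≤ 5 ^ A.card := by exact_mod_cast hTcard
    rw [Finset.card_product]
    push_cast
    calc (T.card : ℝ) * T.card ≤ 5 ^ A.card * 5 ^ A.card := by gcongr
      _ = 25 ^ A.card := by rw [← mul_pow]; norm_num

end Concentration

end GLM

/-! ### Sample size and assembly of the proposition -/

namespace GLM

theorem card_activeSet_le {p : ℕ} (d : ℕ) (β : Vec p) :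
    (activeSet d β).card ≤ d + (nuisanceSupport d β).card := by
  refine (Finset.card_union_le _ _).trans (Nat.add_le_add_right ?_ _)
  have h : (Finset.univ.filter fun j : Fin p => j.val < d).card =
      ((Finset.univ.filter fun j : Fin p => j.val < d).map Fin.valEmbedding).card :=
    (Finset.card_map _).symm
  rw [h]
  refine (Finset.card_le_card fun j hj => ?_).trans (Finset.card_range d).le
  obtain ⟨i, hi, rfl⟩ := Finset.mem_map.1 hj
  exact Finset.mem_range.2 (Finset.mem_filter.1 hi).2

theorem IsSubGaussianVec.exp_inner_le {p : ℕ} {P : Measure (Obs p)} {σ : ℝ}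
    (h : IsSubGaussianVec P Prod.fst σ) {α : Vec p} (hα : ‖α‖ ≤ 1) (r : ℝ) :
    Integrable (fun z => Real.exp (r * inner ℝ z.1 α)) P ∧
      ∫ z, Real.exp (r * inner ℝ z.1 α) ∂P ≤ Real.exp (σ ^ 2 * r ^ 2 / 2) := by
  obtain ⟨h1, h2⟩ := h (r • α)
  simp only [real_inner_smul_left, real_inner_comm _ α] at h1 h2
  refine ⟨h1, h2.trans (Real.exp_le_exp.2 ?_)⟩
  have : ‖r • α‖ ^ 2 ≤ r ^ 2 := by
    rw [norm_smul, mul_pow, Real.norm_eq_abs, sq_abs]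
    exact mul_le_of_le_one_right (sq_nonneg r) (pow_le_one₀ (norm_nonneg _) hα)
  gcongr

/-- A measurable event of large probability inside the complement of a small set. -/
theorem exists_measurableSet_compl {Ω : Type*} [MeasurableSpace Ω] (μ : Measure Ω)
    [IsProbabilityMeasure μ] {B : Set Ω} {q : ℝ} (h : μ.real B ≤ q) :
    ∃ E : Set Ω, MeasurableSet E ∧ 1 - q ≤ μ.real E ∧ ∀ ω ∈ E, ω ∉ B := by
  refine ⟨(toMeasurable μ B)ᶜ, (measurableSet_toMeasurable μ B).compl, ?_,
    fun ω hω hB => hω (subset_toMeasurable μ B hB)⟩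
  rw [probReal_compl_eq_one_sub (measurableSet_toMeasurable μ B), measureReal_def,
    measure_toMeasurable, ← measureReal_def]
  linarith

/-- For the degenerate case `d + s = 0`, where `A` is empty and the restricted norms vanish. -/
theorem measureReal_not_le_of_forall {Ω : Type*} [MeasurableSpace Ω] {μ : Measure Ω}
    {Q : Ω → Prop} (h : ∀ ω, Q ω) {q : ℝ} (hq : 0 ≤ q) : μ.real {ω | ¬ Q ω} ≤ q := by
  have : {ω | ¬ Q ω} = ∅ := Set.eq_empty_of_forall_notMem fun ω hω => hω (h ω)
  rwa [this, measureReal_empty]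

/-- As `log 2 ≤ log p` and `log 2 ≤ 1`, the sample size condition dominates `c₀ log 2 · (D + t)`;
this gives a bound free of `p` and `t`. -/
theorem sqrt_le_sqrt_of_sample_size {c₀ D t n ℓ : ℝ} (hc₀ : 0 < c₀) (hD : 0 ≤ D) (ht : 0 < t)
    (hn : 0 < n) (hℓ : Real.log 2 ≤ ℓ) (h : c₀ * (D * ℓ + t) ≤ n) :
    √((D + t) / n) ≤ √(1 / (c₀ * Real.log 2)) := by
  have hlog : 0 < Real.log 2 := Real.log_pos one_lt_two
  have hlog1 : Real.log 2 ≤ 1 := by linarith [Real.log_two_lt_d9]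
  refine Real.sqrt_le_sqrt ?_
  rw [div_le_div_iff₀ hn (by positivity), one_mul]
  refine le_trans ?_ h
  have h1 : (D + t) * (c₀ * Real.log 2) = c₀ * (D * Real.log 2 + t * Real.log 2) := by ring
  rw [h1]
  gcongr
  nlinarith

end GLM

open GLM in
theorem proposition1
    (σl σu Jl Ju σx σe b₁ b₂ b₃ A₀ c₀ : ℝ)
    (hσl : 0 < σl) (hσu : 0 < σu) (hJl : 0 < Jl) (hJu : 0 < Ju) (hA₀ : 0 < A₀) (hc₀ : 0 < c₀) :
    ∃ C : ℝ, 0 < C ∧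
      ∀ (p d N : ℕ), 2 ≤ p → d ≤ p →
      ∀ (I₁ : Finset (Fin N)) (b : ℝ → ℝ) (βs : GLM.Vec p)
        (P : MeasureTheory.Measure (GLM.Obs p)),
        MeasureTheory.IsProbabilityMeasure P →
        GLM.Regular σl σu Jl Ju σx σe b₁ b₂ b₃ A₀ d b βs P →
      ∀ (Ω : Type*) (mΩ : MeasurableSpace Ω) (μ : MeasureTheory.Measure Ω),
        MeasureTheory.IsProbabilityMeasure μ →
      ∀ Z : Fin N → Ω → GLM.Obs p,
        (∀ i, Measurable (Z i)) → (∀ i, μ.map (Z i) = P) → ProbabilityTheory.iIndepFun Z μ →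
      ∀ (κ L g Rloc Rrst : ℝ), 0 < κ → 0 < L → 0 < g → 0 < Rloc → 0 < Rrst →
      ∀ t : ℝ, 0 < t →
        c₀ * (((d : ℝ) + ((GLM.nuisanceSupport d βs).card : ℝ)) * Real.log p + t)
          ≤ (I₁.card : ℝ) →
      ∃ E : Set Ω, MeasurableSet E ∧ 1 - Real.exp (-t) ≤ μ.real E ∧ ∀ ω ∈ E,
        let s : ℝ := ((GLM.nuisanceSupport d βs).card : ℝ)
        let n₁ : ℝ := (I₁.card : ℝ)
        let A := GLM.activeSet d βs
        let J := GLM.popHessian b P βs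
        let z : Fin N → GLM.Obs p := fun i => Z i ω
        let Lhat : GLM.Vec p → ℝ := GLM.empLoss b Finset.univ z
        let Lhat₁ : GLM.Vec p → ℝ := GLM.empLoss b I₁ z
        GLM.supNorm (gradient Lhat βs) ≤ C * √((Real.log p + t) / N) ∧
        ‖GLM.subvec A (gradient Lhat βs)‖ ≤ C * √(((d : ℝ) + s + t) / N) ∧
        max (GLM.maxNorm (GLM.hessian Lhat βs - J)) (GLM.maxNorm (GLM.hessian Lhat₁ βs - J))
          ≤ C * √((Real.log p + t) / n₁) ∧
        GLM.opNorm (GLM.principal A (GLM.hessian Lhat₁ βs) - GLM.principal A J)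
          ≤ C * √(((d : ℝ) + s + t) / n₁) ∧
        (GLM.SampleRegular κ L g Rloc Rrst b βs I₁ z →
          GLM.RestrictedLipschitzHessian (b₃ * b₁ * L) g Rrst Lhat₁ βs ∧
          GLM.RestrictedLipschitzHessian (b₃ * b₁ * L) g Rrst Lhat βs) := by
  obtain ⟨a, K, ha, hK, hexpsq⟩ := exists_exp_sq_bound σx
  -- `C` is fixed before `b` is given, when `b₂` may still be negative; hence `|b₂|`.
  set a' := a / (|b₂| + 1) with ha'
  have ha'pos : 0 < a' := by positivity
  set ρ := √(1 / (c₀ * Real.log 2)) with hρ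
  have hρ0 : 0 ≤ ρ := Real.sqrt_nonneg _
  -- `ρ` bounds `√((d+s+t)/n₁)`, so `η` times that deviation stays below `a'/2`, the Bernstein
  -- range.
  set η := a' / (2 * (ρ + 1)) with hη
  have hηpos : 0 < η := by positivity
  have hη' : η * ρ ≤ a' / 2 := by
    rw [hη, div_mul_eq_mul_div, div_le_div_iff₀ (by positivity) two_pos]
    nlinarith
  set C₁ := 2 * (σe ^ 2 / 2 + 8) with hC₁
  set C₂ := (|b₂| * b₁ ^ 2) ^ 2 / 2 + 8 with hC₂
  set C₃ := 4 * (8 * K / a' ^ 2 * η + 8 / η) with hC₃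
  have hC₁0 : 0 < C₁ := by positivity
  have hC₂0 : 0 < C₂ := by positivity
  have hC₃0 : 0 < C₃ := by positivity
  refine ⟨C₁ + C₂ + C₃, by positivity, ?_⟩
  set C := C₁ + C₂ + C₃ with hC
  intro p d N hp _ I₁ b βs P hP hreg Ω mΩ μ hμ Z hZ hlaw hind κ L g Rloc Rrst hκ hL hg hRloc hRrst
    t ht hn
  set s := (nuisanceSupport d βs).card with hs
  have hp' : (2 : ℝ) ≤ p := by exact_mod_cast hp
  have hlogp : Real.log 2 ≤ Real.log p := Real.log_le_log two_pos hp'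
  have hlog2 : 0 < Real.log 2 := Real.log_pos one_lt_two
  have hlogp0 : 0 ≤ Real.log p := hlog2.le.trans hlogp
  have hn₁ : (0 : ℝ) < I₁.card := lt_of_lt_of_le (by positivity) hn
  have hI₁ : 0 < I₁.card := by exact_mod_cast hn₁
  have hcardle : I₁.card ≤ N := by simpa using Finset.card_le_univ I₁
  have hNcard : (Finset.univ : Finset (Fin N)).card = N := by simp
  have hNpos : 0 < (Finset.univ : Finset (Fin N)).card := by omega
  have hcont := hreg.contDiff
  have hscore := hreg.subGaussian_score
  have hx := hreg.bounded_cov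
  have h₂ : ∀ u, |iteratedDeriv 2 b u| ≤ |b₂| := fun u => (hreg.bound_two u).trans (le_abs_self _)
  have hexp : ∀ α : Vec p, ‖α‖ ≤ 1 →
      Integrable (fun z : Obs p => Real.exp (a * (inner ℝ z.1 α) ^ 2)) P ∧
        ∫ z, Real.exp (a * (inner ℝ z.1 α) ^ 2) ∂P ≤ K := fun α hα =>
    hexpsq P (fun z => inner ℝ z.1 α) (by fun_prop) (hreg.subGaussian_cov.exp_inner_le hα)
  set q := Real.exp (-t) / 16 with hq
  have hq0 : 0 ≤ q := by positivity
  have hDcast : ((d + s : ℕ) : ℝ) = (d : ℝ) + s := by push_cast; rfl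
  have hscale : √(((d + s : ℕ) + t) / I₁.card) ≤ ρ :=
    sqrt_le_sqrt_of_sample_size hc₀ (Nat.cast_nonneg _) ht hn₁ hlogp (by rwa [hDcast])
  have hA := card_activeSet_le d βs
  have hempty : ¬ 1 ≤ d + s → IsEmpty (activeSet d βs) := fun h => by
    rw [Finset.isEmpty_coe_sort, ← Finset.card_eq_zero]; omega
  have hsup := measure_supNorm_gradient_empLoss (C := C) hp ht hZ hlaw hind hNpos hcont hscore
    (by linarith)
  have hsub : μ.real {ω | ¬ ‖subvec (activeSet d βs)
      (gradient (empLoss b Finset.univ fun i => Z i ω) βs)‖ ≤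
        C * √(((d + s : ℕ) + t) / (Finset.univ : Finset (Fin N)).card)} ≤ q := by
    by_cases hD : 1 ≤ d + s
    · exact measure_norm_subvec_gradient_empLoss ht hZ hlaw hind hNpos hcont hscore hA hD
        (by linarith)
    · have := hempty hD
      refine measureReal_not_le_of_forall (fun ω => ?_) hq0
      rw [Subsingleton.elim (subvec (activeSet d βs) _) 0, norm_zero]
      positivity
  have hmax := measure_maxNorm_hessian_empLoss (C := C) hp ht hZ hlaw hind hNpos hcont h₂ hx hscore
    (by linarith)
  have hmax₁ := measure_maxNorm_hessian_empLoss (C := C) hp ht hZ hlaw hind hI₁ hcont h₂ hx hscore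
    (by linarith)
  have hop : μ.real {ω | ¬ opNorm (principal (activeSet d βs)
      (hessian (empLoss b I₁ fun i => Z i ω) βs) -
        principal (activeSet d βs) (popHessian b P βs)) ≤
          C * √(((d + s : ℕ) + t) / I₁.card)} ≤ q := by
    by_cases hD : 1 ≤ d + s
    · exact measure_opNorm_hessian_empLoss ht hZ hlaw hind hI₁ hcont h₂ hx hscore ha hηpos hexp hA hD
        ((mul_le_mul_of_nonneg_left hscale hηpos.le).trans hη') (by linarith)
    · have := hempty hD
      refine measureReal_not_le_of_forall (fun ω => ?_) hq0
      rw [Subsingleton.elim (principal (activeSet d βs) _ - _) 0, opNorm, map_zero, norm_zero]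
      positivity
  have hbdd : μ.real {ω | ¬ ∀ i, supNorm (Z i ω).1 ≤ b₁} ≤ 0 := by
    have h : ∀ᵐ ω ∂μ, ∀ i, supNorm (Z i ω).1 ≤ b₁ := ae_all_iff.2 fun i => by
      rw [← hlaw i] at hx
      exact ae_of_ae_map (hZ i).aemeasurable hx
    rw [measureReal_def, ae_iff.1 h, ENNReal.toReal_zero]
  -- Five bad events of probability at most `e^{-t}/16` and one null event: `5/16 < 1`.
  obtain ⟨E, hEm, hEp, hE⟩ := exists_measurableSet_compl μ
    ((measureReal_union_le _ _).trans (add_le_add hsup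
      ((measureReal_union_le _ _).trans (add_le_add hsub
        ((measureReal_union_le _ _).trans (add_le_add hmax
          ((measureReal_union_le _ _).trans (add_le_add hmax₁
            ((measureReal_union_le _ _).trans (add_le_add hop hbdd))))))))))
  refine ⟨E, hEm, le_trans ?_ hEp, fun ω hω => ?_⟩
  · linarith [Real.exp_pos (-t)]
  have hgood := hE ω hω
  simp only [Set.mem_union, Set.mem_ofPred_eq, not_or, not_not] at hgood
  obtain ⟨g1, g2, g3, g4, g5, g6⟩ := hgood
  rw [hNcard] at g1 g2 g3
  rw [hDcast] at g2 g5
  refine ⟨g1, g2, max_le (g3.trans ?_) g4, g5, fun hS => ?_⟩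
  -- The full-sample Hessian deviates on the scale `1/√N`, which `n₁ ≤ N` weakens to `1/√n₁`.
  · gcongr
  have hcurv : ∀ v ∈ l1Cone p g ∩ l2Ball p Rrst,
      max ((1 / (I₁.card : ℝ)) * ∑ i ∈ I₁, (inner ℝ (Z i ω).1 v) ^ 2)
        ((1 / (N : ℝ)) * ∑ i, (inner ℝ (Z i ω).1 v) ^ 2) ≤ L * ‖v‖ ^ 2 := fun v hv =>
    -- Regularity is applied at `β = β*`, the centre of the ball of radius `Rloc`, for its
    -- second-moment bound.
    (hS βs (by simpa using hRloc.le) v hv).2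
  refine ⟨restrictedLipschitzHessian_empLoss hcont hreg.differentiable hreg.bound_three
      (Finset.card_pos.1 hI₁) g6 hL.le fun v hv => (le_max_left _ _).trans (hcurv v hv),
    restrictedLipschitzHessian_empLoss hcont hreg.differentiable hreg.bound_three
      (Finset.card_pos.1 hNpos) g6 hL.le fun v hv => ?_⟩
  rw [hNcard]
  exact (le_max_right _ _).trans (hcurv v hv)
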